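/- **Theorem.** Let $M(c)=(M^{2n+1},\varphi,\xi,\eta,g)$ be a Sasakian space form, that is, a Sasakian manifold (a contact metric manifold, $d\eta(X,Y)=g(X,\varphi Y)$ with $d\eta(X,Y)=\tfrac12\big(X\eta(Y)-Y\eta(X)-\eta([X,Y])\big)$, which is normal, $N_\varphi=-2\,d\eta\otimes\xi$) of constant $\varphi$-sectional curvature $c$. Let $\nabla$ be its Levi-Civita connection and $R(X,Y)Z=\nabla_X\nabla_YZ-\nabla_Y\nabla_XZ-\nabla_{[X,Y]}Z$. Let $J\subset\mathbb R$ be an open interval and $\gamma:J\to M(c)$ a smooth Legendre curve (that is, $\eta(\gamma')=0$), parametrized by arc length, which is a Frenet curve of osculating order $r$, $1\le r\le 2n+1$: there are orthonormal smooth vector fields $E_1=T=\gamma',E_2,\dots,E_r$ along $\gamma$ and smooth positive functions $k_1,\dots,k_{r-1}$ on $J$ with $$\nabla_TE_i=-k_{i-1}E_{i-1}+k_iE_{i+1}\qquad(1\le i\le r),$$ where $k_0=0$, $k_i=0$ for $i\ge r$ and $E_i=0$ for $i>r$ by convention. Put $m=\min\{r,4\}$ and let $\delta_1,\delta_2$ be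 real numbers, not both zero. Let $\tau(\gamma)=\nabla_TT$ be the tension field and $\tau_2(\gamma)=\nabla_T\nabla_T\tau(\gamma)-R(T,\tau(\gamma))T$ the bitension field of $\gamma$. Then $\gamma$ is interpolating sesqui-harmonic with parameters $\delta_1,\delta_2$, i.e. $\delta_2\tau_2(\gamma)-\delta_1\tau(\gamma)=0$ on $J$, if and only if the following two conditions hold: 1. $c=1$, or $\varphi T\perp E_2$ along $\gamma$, or $\varphi T\in\operatorname{span}\{E_2,\dots,E_m\}$ along $\gamma$; 2. the first $m$ of the following equations are satisfied on $J$: $$-3\delta_2k_1k_1'=0,$$ $$\delta_2\Big[k_1''-k_1^3-k_1k_2^2+\tfrac{c+3}4k_1+\tfrac{3(c-1)}4k_1\,g(\varphi T,E_2)^2-\tfrac{c-1}4k_1\,\eta(E_2)^2\Big]-\delta_1k_1=0,$$ $$\delta_2\Big[2k_1'k_2+k_1k_2'+\tfrac{3(c-1)}4k_1\,g(\varphi T,E_2)\,g(\varphi T,E_3)-\tfrac{c-1}4k_1\,\eta(E_2)\,\eta(E_3)\Big]=0,$$ $$\delta_2\Big[k_1k_2k_3+\tfrac{3(c-1)}4k_1\,g(\varphi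 T,E_2)\,g(\varphi T,E_4)-\tfrac{c-1}4k_1\,\eta(E_2)\,\eta(E_4)\Big]=0.$$ -/

import Mathlib

open Bundle Set
open scoped Manifold ContDiff

/-! Riemannian manifolds, Sasakian space forms, Frenet curves and the (bi)tension field of a curve.

Throughout, `M` is a smooth manifold without boundary modelled on the finite-dimensional real vector
space `F`, its Riemannian metric `g` is Mathlib's `RiemannianBundle` structure on the tangent bundle
(written `inner ℝ u v` below), and `D` is the Levi-Civita connection; following Mathlib, `D Y x u`
stands for `(∇_u Y)(x)`. -/

namespace SesquiHarmonic

noncomputable section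

section Connection

variable {F : Type*} [NormedAddCommGroup F] [NormedSpace ℝ F] [FiniteDimensional ℝ F]
  {M : Type*} [TopologicalSpace M] [ChartedSpace F M] [IsManifold 𝓘(ℝ, F) ∞ M]

/-- The type of affine connections on `M`, i.e. covariant derivatives on the tangent bundle. -/
abbrev Connection (F : Type*) [NormedAddCommGroup F] [NormedSpace ℝ F] (M : Type*)
    [TopologicalSpace M] [ChartedSpace F M] [IsManifold 𝓘(ℝ, F) ∞ M] :=
  CovariantDerivative 𝓘(ℝ, F) F (fun x : M ↦ TangentSpace 𝓘(ℝ, F) x)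

/-- `D` is the Levi-Civita connection of the Riemannian manifold `M`: it is a smooth connection
(`∇_X Y` is smooth for smooth `X`, `Y`), it is metric, `u g(Y, Z) = g(∇_u Y, Z) + g(Y, ∇_u Z)`, and
it is torsion-free. -/
structure IsLeviCivita [RiemannianBundle (fun x : M ↦ TangentSpace 𝓘(ℝ, F) x)]
    (D : Connection F M) : Prop where
  smooth : CovariantDerivative.ContMDiffCovariantDerivative D ∞
  metric : ∀ (Y Z : Π x : M, TangentSpace 𝓘(ℝ, F) x) (x : M) (u : TangentSpace 𝓘(ℝ, F) x),
    MDiffAt (T% Y) x → MDiffAt (T% Z) x →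
      mvfderiv 𝓘(ℝ, F) (fun y ↦ (inner ℝ (Y y) (Z y) : ℝ)) x u
        = inner ℝ (D Y x u) (Z x) + inner ℝ (Y x) (D Z x u)
  torsion_free : CovariantDerivative.torsion D = 0

/-- The curvature `R(X, Y)Z = ∇_X ∇_Y Z - ∇_Y ∇_X Z - ∇_{[X, Y]} Z` on vector fields. -/
def curvatureField (D : Connection F M) (X Y Z : Π x : M, TangentSpace 𝓘(ℝ, F) x) (x : M) :
    TangentSpace 𝓘(ℝ, F) x :=
  D (fun y ↦ D Z y (Y y)) x (X x) - D (fun y ↦ D Z y (X y)) x (Y x)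
    - D Z x (VectorField.mlieBracket 𝓘(ℝ, F) X Y x)

/-- The curvature tensor `R(u, v)w` on tangent vectors at `x`: the vectors are extended to smooth
vector fields near `x`, and the result does not depend on the extensions. -/
def curvature (D : Connection F M) (x : M) (u v w : TangentSpace 𝓘(ℝ, F) x) :
    TangentSpace 𝓘(ℝ, F) x :=
  curvatureField D (FiberBundle.extend F u) (FiberBundle.extend F v) (FiberBundle.extend F w) x

/-- The velocity `T = γ'` of a curve. -/
def velocity (γ : ℝ → M) (t : ℝ) : TangentSpace 𝓘(ℝ, F) (γ t) :=
  mfderiv 𝓘(ℝ, ℝ) 𝓘(ℝ, F) γ t (1 : ℝ)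

/-- The covariant derivative `∇_T V` at time `t` of a vector field `V` along the curve `γ`.
In the frame `∂₁, …, ∂_d` of the chart at `γ t`, write `V s = ∑ᵢ Vⁱ(s) ∂ᵢ(γ s)`; then
`(∇_T V)(t) = ∑ᵢ (Vⁱ)'(t) ∂ᵢ + ∑ᵢ Vⁱ(t) ∇_{γ'(t)} ∂ᵢ`. The second sum is `∇_{γ'(t)}` of the field
with the constant components `Vⁱ(t)` near `γ t`, which is Mathlib's `FiberBundle.extend`. -/
def covDerivAlong (D : Connection F M) (γ : ℝ → M)
    (V : Π t : ℝ, TangentSpace 𝓘(ℝ, F) (γ t)) (t : ℝ) :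
    TangentSpace 𝓘(ℝ, F) (γ t) :=
  (trivializationAt F (fun x : M ↦ TangentSpace 𝓘(ℝ, F) x) (γ t)).symm (γ t)
    (deriv (fun s : ℝ ↦
      ((trivializationAt F (fun x : M ↦ TangentSpace 𝓘(ℝ, F) x) (γ t)) ⟨γ s, V s⟩).2) t)
  + D (FiberBundle.extend F (V t)) (γ t) (velocity γ t)

/-- The tension field `τ(γ) = tr(∇dγ) = ∇_T T` of a curve, the interval carrying the metric
`dt²`. -/
def tension (D : Connection F M) (γ : ℝ → M) (t : ℝ) : TangentSpace 𝓘(ℝ, F) (γ t) :=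
  covDerivAlong D γ (velocity γ) t

/-- The bitension field `τ₂(γ) = ∇_T ∇_T τ(γ) - R(T, τ(γ))T` of a curve. -/
def bitension (D : Connection F M) (γ : ℝ → M) (t : ℝ) : TangentSpace 𝓘(ℝ, F) (γ t) :=
  covDerivAlong D γ (covDerivAlong D γ (tension D γ)) t
    - curvature D (γ t) (velocity γ t) (tension D γ t) (velocity γ t)

/-- `γ : J → M` is interpolating sesqui-harmonic with parameters `δ₁, δ₂`, i.e.
`δ₂ τ₂(γ) - δ₁ τ(γ) = 0`. -/
def IsInterpolatingSesquiHarmonic (D : Connection F M) (δ₁ δ₂ : ℝ) (J : Set ℝ) (γ : ℝ → M) :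
    Prop :=
  ∀ t ∈ J, δ₂ • bitension D γ t - δ₁ • tension D γ t = 0

/-- `γ : J → M` (with `J` an open interval) is a smooth curve parametrized by arc length and a
Frenet curve of osculating order `r`: there are orthonormal smooth vector fields `E₁ = T, …, E_r`
along `γ` and smooth positive functions (curvatures) `k₁, …, k_{r-1}` with
`∇_T E₁ = k₁ E₂`, `∇_T E_i = -k_{i-1} E_{i-1} + k_i E_{i+1}` for `1 < i < r`, and
`∇_T E_r = -k_{r-1} E_{r-1}`. The symbols `k_i` for `i = 0` or `i ≥ r`, and `E_i` for `i > r`, that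
are not part of the Frenet apparatus denote `0`. (`E 0` is never used.) -/
structure IsFrenetCurve [RiemannianBundle (fun x : M ↦ TangentSpace 𝓘(ℝ, F) x)]
    (D : Connection F M) (J : Set ℝ) (γ : ℝ → M) (r : ℕ)
    (E : ℕ → Π t : ℝ, TangentSpace 𝓘(ℝ, F) (γ t)) (k : ℕ → ℝ → ℝ) : Prop where
  one_le : 1 ≤ r
  le_dim : r ≤ Module.finrank ℝ F
  smooth_curve : ContMDiffOn 𝓘(ℝ, ℝ) 𝓘(ℝ, F) ∞ γ J
  smooth_frame : ∀ i, 1 ≤ i → i ≤ r →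
    ContMDiffOn 𝓘(ℝ, ℝ) 𝓘(ℝ, F).tangent ∞
      (fun t ↦ (⟨γ t, E i t⟩ : TangentBundle 𝓘(ℝ, F) M)) J
  smooth_curvature : ∀ i, 1 ≤ i → i < r → ContDiffOn ℝ ∞ (k i) J
  orthonormal : ∀ t ∈ J, ∀ i j, 1 ≤ i → i ≤ r → 1 ≤ j → j ≤ r →
    inner ℝ (E i t) (E j t) = if i = j then (1 : ℝ) else 0
  frame_one : ∀ t ∈ J, E 1 t = velocity γ t
  curvature_pos : ∀ i, 1 ≤ i → i < r → ∀ t ∈ J, 0 < k i t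
  frame_eq_zero : ∀ i, r < i → ∀ t ∈ J, E i t = 0
  curvature_zero : ∀ t ∈ J, k 0 t = 0
  curvature_eq_zero : ∀ i, r ≤ i → ∀ t ∈ J, k i t = 0
  frenet : ∀ i, 1 ≤ i → i ≤ r → ∀ t ∈ J,
    covDerivAlong D γ (E i) t = -(k (i - 1) t) • E (i - 1) t + k i t • E (i + 1) t

end Connection

section Sasakian

variable (F : Type*) [NormedAddCommGroup F] [NormedSpace ℝ F] [FiniteDimensional ℝ F]
  (M : Type*) [TopologicalSpace M] [ChartedSpace F M] [IsManifold 𝓘(ℝ, F) ∞ M]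
  [RiemannianBundle (fun x : M ↦ TangentSpace 𝓘(ℝ, F) x)]

/-- An almost contact metric structure `(φ, ξ, η, g)` on `M`, where `g` is the Riemannian metric
of `M`: smooth tensor fields with `φ² = -Id + η ⊗ ξ`, `η(ξ) = 1` and
`g(φX, φY) = g(X, Y) - η(X) η(Y)`. -/
structure AlmostContactMetric where
  φ : Π x : M, TangentSpace 𝓘(ℝ, F) x →L[ℝ] TangentSpace 𝓘(ℝ, F) x
  ξ : Π x : M, TangentSpace 𝓘(ℝ, F) x
  η : Π x : M, TangentSpace 𝓘(ℝ, F) x →L[ℝ] ℝ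
  smooth_φ : ContMDiff 𝓘(ℝ, F) (𝓘(ℝ, F).prod 𝓘(ℝ, F →L[ℝ] F)) ∞
    (fun x ↦ TotalSpace.mk' (F →L[ℝ] F)
      (E := fun x : M ↦ TangentSpace 𝓘(ℝ, F) x →L[ℝ] TangentSpace 𝓘(ℝ, F) x)
      x (φ x))
  smooth_ξ : ContMDiff 𝓘(ℝ, F) 𝓘(ℝ, F).tangent ∞
    (fun x ↦ (⟨x, ξ x⟩ : TangentBundle 𝓘(ℝ, F) M))
  smooth_η : ContMDiff 𝓘(ℝ, F) (𝓘(ℝ, F).prod 𝓘(ℝ, F →L[ℝ] ℝ)) ∞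
    (fun x ↦ TotalSpace.mk' (F →L[ℝ] ℝ)
      (E := fun x : M ↦ TangentSpace 𝓘(ℝ, F) x →L[ℝ] Bundle.Trivial M ℝ x) x (η x))
  φ_φ : ∀ (x : M) (u : TangentSpace 𝓘(ℝ, F) x), φ x (φ x u) = -u + η x u • ξ x
  η_ξ : ∀ x : M, η x (ξ x) = 1
  inner_φ_φ : ∀ (x : M) (u v : TangentSpace 𝓘(ℝ, F) x),
    inner ℝ (φ x u) (φ x v) = (inner ℝ u v : ℝ) - η x u * η x v

namespace AlmostContactMetric

variable {F M}

/-- The exterior derivative `dη(X, Y) = ½ (X(η(Y)) - Y(η(X)) - η([X, Y]))` on vector fields, with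
the factor `½` that is customary in contact metric geometry. -/
def dη (S : AlmostContactMetric F M) (X Y : Π x : M, TangentSpace 𝓘(ℝ, F) x) (x : M) : ℝ :=
  (1 / 2 : ℝ) *
    (mvfderiv 𝓘(ℝ, F) (fun y ↦ S.η y (Y y)) x (X x)
      - mvfderiv 𝓘(ℝ, F) (fun y ↦ S.η y (X y)) x (Y x)
      - S.η x (VectorField.mlieBracket 𝓘(ℝ, F) X Y x))

/-- The Nijenhuis tensor
`N_φ(X, Y) = φ²[X, Y] + [φX, φY] - φ[φX, Y] - φ[X, φY]` on vector fields. -/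
def nijenhuis (S : AlmostContactMetric F M) (X Y : Π x : M, TangentSpace 𝓘(ℝ, F) x)
    (x : M) : TangentSpace 𝓘(ℝ, F) x :=
  S.φ x (S.φ x (VectorField.mlieBracket 𝓘(ℝ, F) X Y x))
    + VectorField.mlieBracket 𝓘(ℝ, F) (fun y ↦ S.φ y (X y)) (fun y ↦ S.φ y (Y y)) x
    - S.φ x (VectorField.mlieBracket 𝓘(ℝ, F) (fun y ↦ S.φ y (X y)) Y x)
    - S.φ x (VectorField.mlieBracket 𝓘(ℝ, F) X (fun y ↦ S.φ y (Y y)) x)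

/-- The structure is Sasakian: it is contact metric, `dη(X, Y) = g(X, φY)`, and normal,
`N_φ = -2 dη ⊗ ξ`. Both identities are tensorial; they are stated at each point for all vector
fields that are differentiable there. -/
structure IsSasakian (S : AlmostContactMetric F M) : Prop where
  contact : ∀ (X Y : Π x : M, TangentSpace 𝓘(ℝ, F) x) (x : M),
    MDiffAt (T% X) x → MDiffAt (T% Y) x → S.dη X Y x = inner ℝ (X x) (S.φ x (Y x))
  normal : ∀ (X Y : Π x : M, TangentSpace 𝓘(ℝ, F) x) (x : M),
    MDiffAt (T% X) x → MDiffAt (T% Y) x → S.nijenhuis X Y x = -(2 * S.dη X Y x) • S.ξ x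

/-- `M(c)` is a Sasakian space form: a Sasakian manifold all of whose `φ`-sections, i.e. the planes
spanned by `u` and `φu` with `u` a unit vector orthogonal to `ξ`, have sectional curvature `c`. -/
structure IsSasakianSpaceForm (S : AlmostContactMetric F M) (D : Connection F M) (c : ℝ) :
    Prop where
  sasakian : S.IsSasakian
  phi_sectional : ∀ (x : M) (u : TangentSpace 𝓘(ℝ, F) x),
    inner ℝ u u = (1 : ℝ) → inner ℝ u (S.ξ x) = (0 : ℝ) →
      inner ℝ (curvature D x u (S.φ x u) (S.φ x u)) u = c

end AlmostContactMetric

end Sasakian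

end

end SesquiHarmonic

open SesquiHarmonic

/-! Write f = g(φT, E₂). Differentiating η(T) = 0 along γ and using ∇ξ = -φ gives k₁ η(E₂) = g(T,
φT) = 0. Hence T and τ(γ) = k₁E₂ are orthogonal to ξ, and only the curvature of the contact
distribution enters: R(v, u)u = (c+3)/4 (g(u,u)v - g(u,v)u) + 3(c-1)/4 g(v, φu) φu. Together with
the Frenet equations, this makes δ₂τ₂ - δ₁τ a combination of E₁, …, E₄ and φT (`bitension_eq`).
Since φT ⊥ E₁, splitting φT into its components along E₂, E₃, E₄ and an orthogonal remainder N gives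
the four scalar equations and, separately, δ₂(c-1)k₁ f N = 0 (`sesquiHarmonic_iff`).

The last equation is only a pointwise alternative, whereas condition 1 requires f = 0 on all of J or
N = 0 on all of J. The bridge is `inner_φ_sq_eq`, used when r ≥ 2, c ≠ 1 and δ₂ ≠ 0. There k₁ is
constant by the first equation, and f' = k₂ g(φT, E₃). The second equation makes 3(c-1)/4 f² - k₂²
constant, so 3(c-1) f f' = 4 k₂k₂'. The third equation times k₂ gives 4 k₂k₂' = -3(c-1) f f'.
Therefore f f' = 0 and f² is constant on the interval: if f is nonzero somewhere, it is nonzero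
everywhere, and N vanishes identically.

The curvature formula is derived from the definitions. Pointwise linear algebra
(`covDeriv_structure_tensors`) gives ∇ξ = -φ and (∇_uφ)Y = g(u,Y)ξ - η(Y)u. Differentiating again
gives R(u,v)ξ and the commutator of R(u,v) with φ. On ξ^⊥ the difference between R and the model
tensor is then φ-invariant with zero holomorphic sectional curvature, so its sectional curvature
vanishes (`curvature_eq_zero_of_holomorphic`, used in `curvature_of_phi_sectional`). -/

namespace SesquiHarmonic

noncomputable section

open Topology

set_option linter.unusedSectionVars false

/-! ### Globally smooth vector fields and tensoriality. -/

section Fields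

variable {F : Type*} [NormedAddCommGroup F] [NormedSpace ℝ F] [FiniteDimensional ℝ F]
  {M : Type*} [TopologicalSpace M] [ChartedSpace F M] [IsManifold 𝓘(ℝ, F) ∞ M]

/-- The vector field `X` is smooth on all of `M`. -/
def SmoothField (X : Π x : M, TangentSpace 𝓘(ℝ, F) x) : Prop :=
  ContMDiff 𝓘(ℝ, F) 𝓘(ℝ, F).tangent ∞ (fun x ↦ (⟨x, X x⟩ : TangentBundle 𝓘(ℝ, F) M))

/-- The function `f` is smooth on all of `M`. -/
def SmoothFun (F : Type*) [NormedAddCommGroup F] [NormedSpace ℝ F] {M : Type*} [TopologicalSpace M]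
    [ChartedSpace F M] (f : M → ℝ) : Prop :=
  ContMDiff 𝓘(ℝ, F) 𝓘(ℝ, ℝ) ∞ f

variable {X Y Z : Π x : M, TangentSpace 𝓘(ℝ, F) x} {f : M → ℝ}

lemma SmoothFun.mdiffAt (hf : SmoothFun F f) (x : M) : MDiffAt f x :=
  (hf x).mdifferentiableAt (by simp)

lemma SmoothField.mdiffAt (hX : SmoothField X) (x : M) : MDiffAt (T% X) x :=
  (hX x).mdifferentiableAt (by simp)

lemma SmoothField.add (hX : SmoothField X) (hY : SmoothField Y) : SmoothField (X + Y) :=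
  ContMDiff.add_section hX hY

lemma SmoothField.sub (hX : SmoothField X) (hY : SmoothField Y) : SmoothField (X - Y) :=
  ContMDiff.sub_section hX hY

lemma SmoothField.smul (hf : SmoothFun F f) (hX : SmoothField X) : SmoothField (f • X) :=
  ContMDiff.smul_section hf hX

lemma SmoothField.const_smul (a : ℝ) (hX : SmoothField X) : SmoothField (a • X) :=
  ContMDiff.const_smul_section hX

lemma SmoothField.sum {ι : Type*} (s : Finset ι) {X : ι → Π x : M, TangentSpace 𝓘(ℝ, F) x}
    (hX : ∀ i ∈ s, SmoothField (X i)) : SmoothField (fun x ↦ ∑ i ∈ s, X i x) :=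
  ContMDiff.sum_section hX

lemma SmoothField.mlieBracket (hX : SmoothField X) (hY : SmoothField Y) :
    SmoothField (VectorField.mlieBracket 𝓘(ℝ, F) X Y) := fun x ↦
  have : IsManifold 𝓘(ℝ, F) (minSmoothness ℝ 2) M :=
    .of_le (n := ∞) (by simpa using (WithTop.coe_le_coe.2 le_top : ((2 : ℕ∞) : ℕ∞ω) ≤ ∞))
  have : IsManifold 𝓘(ℝ, F) ((⊤ : ℕ∞) + 1) M := ‹IsManifold 𝓘(ℝ, F) ∞ M›
  ContMDiffAt.mlieBracket_vectorField (n := ⊤) (hX x) (hY x) (by simp)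

lemma SmoothField.inner [RiemannianBundle (fun x : M ↦ TangentSpace 𝓘(ℝ, F) x)]
    [IsContMDiffRiemannianBundle 𝓘(ℝ, F) ∞ F (fun x : M ↦ TangentSpace 𝓘(ℝ, F) x)]
    (hX : SmoothField X) (hY : SmoothField Y) :
    SmoothFun F (fun x ↦ (inner ℝ (X x) (Y x) : ℝ)) :=
  ContMDiff.inner_bundle hX hY

variable [T2Space M]

/-- A single bump function in a chart suffices: only the Hausdorff property and finite dimension are
needed, not paracompactness. -/
lemma exists_bump (x : M) {s : Set M} (hs : s ∈ 𝓝 x) :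
    ∃ ψ : M → ℝ, SmoothFun F ψ ∧ ψ =ᶠ[𝓝 x] 1 ∧ tsupport ψ ⊆ s := by
  obtain ⟨f, -, hf⟩ := (SmoothBumpFunction.nhds_basis_tsupport (I := 𝓘(ℝ, F)) x).mem_iff.1 hs
  exact ⟨f, f.contMDiff, f.eventuallyEq_one, hf⟩

/-- Every tangent vector is the value of a global smooth vector field that agrees near the base
point with the field of constant components. -/
lemma exists_smoothField {x : M} (u : TangentSpace 𝓘(ℝ, F) x) :
    ∃ X : Π y : M, TangentSpace 𝓘(ℝ, F) y, SmoothField X ∧ X x = u ∧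
      ∀ᶠ y in 𝓝 x, X y = FiberBundle.extend F u y := by
  obtain ⟨s, hs, hsu⟩ := FiberBundle.exists_contMDiffOn_extend (k := ∞) 𝓘(ℝ, F) F u
  obtain ⟨ψ, hψ, hψ1, hψs⟩ := exists_bump (F := F) x (interior_mem_nhds.2 hs)
  refine ⟨ψ • FiberBundle.extend F u, ?_, ?_, ?_⟩
  · exact ContMDiffOn.smul_section_of_tsupport hψ.contMDiffOn isOpen_interior hψs
      (hsu.mono interior_subset)
  · have := hψ1.self_of_nhds
    simp only [Pi.one_apply] at this
    simp [this]
  · filter_upwards [hψ1] with y hy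
    simp only [Pi.one_apply] at hy
    simp [hy]

/-- A `C^∞`-linear map on smooth vector fields with scalars evaluated at `x` depends only on the
value of the vector field at `x`. -/
lemma eq_of_apply_eq {A : Type*} [AddCommGroup A] [Module ℝ A] {x : M}
    (Φ : (Π y : M, TangentSpace 𝓘(ℝ, F) y) → A)
    (hadd : ∀ X Y, SmoothField X → SmoothField Y → Φ (X + Y) = Φ X + Φ Y)
    (hsmul : ∀ f X, SmoothFun F f → SmoothField X → Φ (f • X) = f x • Φ X)
    (hX : SmoothField X) (hY : SmoothField Y) (hXY : X x = Y x) : Φ X = Φ Y := by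
  have hzero : Φ 0 = 0 := by
    simpa using hsmul (0 : M → ℝ) 0 contMDiff_const (contMDiff_zeroSection _ _)
  have hsum : ∀ {ι : Type _} (s : Finset ι) (V : ι → Π y : M, TangentSpace 𝓘(ℝ, F) y),
      (∀ i, SmoothField (V i)) → Φ (fun y ↦ ∑ i ∈ s, V i y) = ∑ i ∈ s, Φ (V i) := by
    intro ι s V hV
    classical
    induction s using Finset.induction_on with
    | empty =>
      simp only [Finset.sum_empty]
      exact hzero
    | insert a s ha h =>
      simp only [Finset.sum_insert ha, ← h]
      exact hadd _ _ (hV a) (SmoothField.sum s fun i _ ↦ hV i)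
  let t := trivializationAt F (fun y : M ↦ TangentSpace 𝓘(ℝ, F) y) x
  have hx : x ∈ t.baseSet := FiberBundle.mem_baseSet_trivializationAt F _ x
  obtain ⟨ψ, hψ, hψ1, hψs⟩ := exists_bump (F := F) x (t.open_baseSet.mem_nhds hx)
  have hψx : ψ x = 1 := hψ1.self_of_nhds
  let b := Module.Basis.ofVectorSpace ℝ F
  let s := t.localFrame b
  let c := t.localFrameCoeff 𝓘(ℝ, F) b
  have hs : ∀ i, SmoothField (ψ • s i) := fun i ↦
    ContMDiffOn.smul_section_of_tsupport hψ.contMDiffOn t.open_baseSet hψs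
      (t.contMDiffOn_localFrame_baseSet ∞ b i)
  have hc : ∀ {X : Π y : M, TangentSpace 𝓘(ℝ, F) y} (_ : SmoothField X) (i),
      SmoothFun F (fun y ↦ ψ y * c i y (X y)) := by
    intro X hX i
    refine contMDiff_of_tsupport fun y hy ↦ ?_
    have hy' : y ∈ t.baseSet := hψs (tsupport_mul_subset_left hy)
    exact (hψ y).mul (contMDiffAt_localFrameCoeff b hy' (hX y) i)
  have key : ∀ {X : Π y : M, TangentSpace 𝓘(ℝ, F) y} (_ : SmoothField X),
      Φ X = ∑ i, c i x (X x) • Φ (ψ • s i) := by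
    intro X hX
    -- Two cut-offs are inserted: one makes the local frame global, the other makes the coefficients
    -- global. Neither changes Φ, because ψ x = 1.
    have h1 : Φ (ψ • (ψ • X)) = Φ X := by
      rw [hsmul _ _ hψ (hX.smul hψ), hsmul _ _ hψ hX, hψx, one_smul, one_smul]
    have h2 : ψ • (ψ • X) = fun y ↦ ∑ i, ((fun y ↦ ψ y * c i y (X y)) • (ψ • s i)) y := by
      funext y
      by_cases hy : y ∈ t.baseSet
      · conv_lhs => rw [Pi.smul_apply', Pi.smul_apply',
          Bundle.Trivialization.eq_sum_localFrameCoeff_smul (b := b) (I := 𝓘(ℝ, F)) (s := X) hy]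
        simp only [Finset.smul_sum, Pi.smul_apply', smul_smul]
        refine Finset.sum_congr rfl fun i _ ↦ ?_
        congr 1
        simp only [c]
        ring
      · have : ψ y = 0 := image_eq_zero_of_notMem_tsupport fun h ↦ hy (hψs h)
        simp [this]
    rw [← h1, h2, hsum _ _ fun i ↦ (hs i).smul (hc hX i)]
    refine Finset.sum_congr rfl fun i _ ↦ ?_
    rw [hsmul _ _ (hc hX i) (hs i), hψx, one_mul]
  rw [key hX, key hY, hXY]

end Fields

/-! ### Calculus of a connection on globally smooth fields. -/

section Curvature

variable {F : Type*} [NormedAddCommGroup F] [NormedSpace ℝ F] [FiniteDimensional ℝ F]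
  {M : Type*} [TopologicalSpace M] [ChartedSpace F M] [IsManifold 𝓘(ℝ, F) ∞ M]
  {D : Connection F M} {X Y Z : Π x : M, TangentSpace 𝓘(ℝ, F) x} {f : M → ℝ} {x : M}

/-- The vector field `∇_X Y`. -/
def nabla (D : Connection F M) (X Y : Π x : M, TangentSpace 𝓘(ℝ, F) x) :
    Π x : M, TangentSpace 𝓘(ℝ, F) x :=
  fun x ↦ D Y x (X x)

lemma nabla_apply (D : Connection F M) (X Y : Π x : M, TangentSpace 𝓘(ℝ, F) x) (x : M) :
    nabla D X Y x = D Y x (X x) := rfl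

lemma curvatureField_eq (D : Connection F M) (X Y Z : Π x : M, TangentSpace 𝓘(ℝ, F) x) (x : M) :
    curvatureField D X Y Z x = nabla D X (nabla D Y Z) x - nabla D Y (nabla D X Z) x
      - nabla D (VectorField.mlieBracket 𝓘(ℝ, F) X Y) Z x := rfl

lemma SmoothField.nabla (hD : CovariantDerivative.ContMDiffCovariantDerivative D ∞)
    (hX : SmoothField X) (hY : SmoothField Y) : SmoothField (nabla D X Y) :=
  ContMDiff.clm_bundle_apply (n := ∞) (F₁ := F) (F₂ := F)
    (E₁ := fun x : M ↦ TangentSpace 𝓘(ℝ, F) x) (E₂ := fun x : M ↦ TangentSpace 𝓘(ℝ, F) x)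
    (contMDiffOn_univ.1 (hD.contMDiff.contMDiff (contMDiffOn_univ.2 hY))) hX

lemma nabla_add_left : nabla D (X + Y) Z = nabla D X Z + nabla D Y Z := by
  funext x; simp [nabla]

lemma nabla_sub_left : nabla D (X - Y) Z = nabla D X Z - nabla D Y Z := by
  funext x; simp [nabla]

lemma nabla_smul_left : nabla D (f • X) Y = f • nabla D X Y := by
  funext x; simp [nabla]

lemma nabla_add (hY : SmoothField Y) (hZ : SmoothField Z) :
    nabla D X (Y + Z) = nabla D X Y + nabla D X Z := by
  funext x
  simp [nabla, D.isCovariantDerivativeOn.add (hY.mdiffAt x) (hZ.mdiffAt x)]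

lemma nabla_const_smul (a : ℝ) (hY : SmoothField Y) :
    nabla D X (a • Y) = a • nabla D X Y := by
  funext x
  simp [nabla, D.isCovariantDerivativeOn.smul_const a (hY.mdiffAt x)]

lemma nabla_sub (hY : SmoothField Y) (hZ : SmoothField Z) :
    nabla D X (Y - Z) = nabla D X Y - nabla D X Z := by
  have : Y - Z = Y + (-1 : ℝ) • Z := by simp [sub_eq_add_neg]
  rw [this, nabla_add hY (hZ.const_smul _), nabla_const_smul _ hZ]
  simp [sub_eq_add_neg]

lemma nabla_smul (hf : SmoothFun F f) (hY : SmoothField Y) :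
    nabla D X (f • Y) = f • nabla D X Y + (fun x ↦ mvfderiv 𝓘(ℝ, F) f x (X x)) • Y := by
  funext x
  simp [nabla, D.isCovariantDerivativeOn.leibniz (hY.mdiffAt x) (hf.mdiffAt x)]

lemma SmoothFun.mvfderiv_apply (hf : SmoothFun F f) (hX : SmoothField X) :
    SmoothFun F (fun x ↦ mvfderiv 𝓘(ℝ, F) f x (X x)) := by
  have h := (ContMDiff.contMDiff_tangentMap (m := ∞) (n := ∞) hf (by simp)).comp hX
  exact (contMDiff_snd_tangentBundle_modelSpace ℝ 𝓘(ℝ, ℝ)).comp h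

variable [T2Space M] [RiemannianBundle (fun x : M ↦ TangentSpace 𝓘(ℝ, F) x)]

lemma IsLeviCivita.mlieBracket_eq (hD : IsLeviCivita D) (hX : SmoothField X) (hY : SmoothField Y) :
    VectorField.mlieBracket 𝓘(ℝ, F) X Y = nabla D X Y - nabla D Y X := by
  funext x
  exact (D.torsion_eq_zero_iff.1 hD.torsion_free (hX.mdiffAt x) (hY.mdiffAt x)).symm

/-- The commutator of two vector fields acting on functions is their Lie bracket. -/
lemma mvfderiv_mlieBracket (hX : SmoothField X) (hY : SmoothField Y)
    (hf : SmoothFun F f) (x : M) :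
    mvfderiv 𝓘(ℝ, F) (fun y ↦ mvfderiv 𝓘(ℝ, F) f y (Y y)) x (X x)
      - mvfderiv 𝓘(ℝ, F) (fun y ↦ mvfderiv 𝓘(ℝ, F) f y (X y)) x (Y x)
      = mvfderiv 𝓘(ℝ, F) f x (VectorField.mlieBracket 𝓘(ℝ, F) X Y x) := by
  have hfX := hf.mvfderiv_apply hX
  have hfY := hf.mvfderiv_apply hY
  -- The argument tests against a field that is nonzero at x; if the tangent space is trivial there
  -- is none, but then both sides vanish.
  by_cases hu : ∃ u : TangentSpace 𝓘(ℝ, F) x, u ≠ 0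
  swap
  · push Not at hu
    simp [hu (X x), hu (Y x), hu (VectorField.mlieBracket 𝓘(ℝ, F) X Y x)]
  obtain ⟨u, hu⟩ := hu
  obtain ⟨Z, hZ, hZx, -⟩ := exists_smoothField u
  have h2 : ∀ {W : Π x : M, TangentSpace 𝓘(ℝ, F) x}, SmoothField W →
      ContMDiffAt 𝓘(ℝ, F) 𝓘(ℝ, F).tangent (minSmoothness ℝ 2)
        (fun x ↦ (⟨x, W x⟩ : TangentBundle 𝓘(ℝ, F) M)) x := fun hW ↦
    (hW x).of_le (by simpa using (WithTop.coe_le_coe.2 le_top : ((2 : ℕ∞) : ℕ∞ω) ≤ ∞))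
  have h3 : IsManifold 𝓘(ℝ, F) (minSmoothness ℝ 3) M :=
    .of_le (n := ∞) (by simpa using (WithTop.coe_le_coe.2 le_top : ((3 : ℕ∞) : ℕ∞ω) ≤ ∞))
  -- The Jacobi identity for X, Y, fZ minus f times the one for X, Y, Z leaves the desired scalar
  -- identity multiplied by Z x ≠ 0.
  have key := VectorField.leibniz_identity_mlieBracket_apply (h2 hX) (h2 hY) (h2 (hZ.smul hf))
  have keyZ := VectorField.leibniz_identity_mlieBracket_apply (h2 hX) (h2 hY) (h2 hZ)
  have expand : ∀ {W V : Π x : M, TangentSpace 𝓘(ℝ, F) x}, SmoothField V →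
      VectorField.mlieBracket 𝓘(ℝ, F) W (f • V)
        = (fun y ↦ mvfderiv 𝓘(ℝ, F) f y (W y)) • V + f • VectorField.mlieBracket 𝓘(ℝ, F) W V := by
    intro W V hV
    funext y
    exact VectorField.mlieBracket_smul_right (hf.mdiffAt y) (hV.mdiffAt y)
  have expand2 : ∀ {W V : Π x : M, TangentSpace 𝓘(ℝ, F) x}, SmoothField V → SmoothField W →
      SmoothFun F (fun y ↦ mvfderiv 𝓘(ℝ, F) f y (W y)) →
      ∀ U : Π x : M, TangentSpace 𝓘(ℝ, F) x,
      VectorField.mlieBracket 𝓘(ℝ, F) U ((fun y ↦ mvfderiv 𝓘(ℝ, F) f y (W y)) • V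
        + f • VectorField.mlieBracket 𝓘(ℝ, F) W V) x =
      mvfderiv 𝓘(ℝ, F) (fun y ↦ mvfderiv 𝓘(ℝ, F) f y (W y)) x (U x) • V x
      + mvfderiv 𝓘(ℝ, F) f x (W x) • VectorField.mlieBracket 𝓘(ℝ, F) U V x
      + mvfderiv 𝓘(ℝ, F) f x (U x) • VectorField.mlieBracket 𝓘(ℝ, F) W V x
      + f x • VectorField.mlieBracket 𝓘(ℝ, F) U (VectorField.mlieBracket 𝓘(ℝ, F) W V) x := by
    intro W V hV hW hfW U
    rw [VectorField.mlieBracket_add_right ((hV.smul hfW).mdiffAt x)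
      (((hW.mlieBracket hV).smul hf).mdiffAt x),
      VectorField.mlieBracket_smul_right (hfW.mdiffAt x) (hV.mdiffAt x),
      VectorField.mlieBracket_smul_right (hf.mdiffAt x) ((hW.mlieBracket hV).mdiffAt x)]
    module
  rw [expand hZ, expand hZ, expand hZ, expand2 hZ hY hfY, expand2 hZ hX hfX] at key
  simp only [Pi.add_apply, Pi.smul_apply', keyZ, hZx] at key
  refine smul_left_injective ℝ hu ?_
  simp only [sub_smul]
  linear_combination (norm := module) key

lemma IsLeviCivita.mvfderiv_inner (hD : IsLeviCivita D) (hY : SmoothField Y) (hZ : SmoothField Z)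
    (x : M) (u : TangentSpace 𝓘(ℝ, F) x) :
    mvfderiv 𝓘(ℝ, F) (fun y ↦ (inner ℝ (Y y) (Z y) : ℝ)) x u
      = inner ℝ (D Y x u) (Z x) + inner ℝ (Y x) (D Z x u) :=
  hD.metric Y Z x u (hY.mdiffAt x) (hZ.mdiffAt x)


/-! ### Tensoriality and symmetries of the curvature. -/

section CurvatureTensor

variable {W : Π x : M, TangentSpace 𝓘(ℝ, F) x}

/-- `curvature` is built on extensions with constant components, which are controlled only near the
point; locality allows them to be replaced by global smooth fields. -/
lemma curvatureField_congr (hD : IsLeviCivita D) {X' Y' Z' : Π x : M, TangentSpace 𝓘(ℝ, F) x}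
    (hX : SmoothField X) (hY : SmoothField Y) (hZ : SmoothField Z)
    (hXX' : ∀ᶠ y in 𝓝 x, X y = X' y) (hYY' : ∀ᶠ y in 𝓝 x, Y y = Y' y)
    (hZZ' : ∀ᶠ y in 𝓝 x, Z y = Z' y) :
    curvatureField D X Y Z x = curvatureField D X' Y' Z' x := by
  have hcongr : ∀ {V V' : Π x : M, TangentSpace 𝓘(ℝ, F) x} (_ : SmoothField V)
      (_ : ∀ᶠ y in 𝓝 x, V y = V' y), ∀ᶠ y in 𝓝 x, D V y = D V' y := by
    intro V V' hV hVV'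
    filter_upwards [hVV'.eventually_nhds] with y hy
    refine D.isCovariantDerivativeOn.congr_of_eventuallyEq (hV.mdiffAt y) ?_ Filter.univ_mem hy
    exact (hV.mdiffAt y).congr_of_eventuallyEq (by
      filter_upwards [hy] with z hz
      simp [hz])
  have h1 : D (fun y ↦ D Z y (Y y)) x = D (fun y ↦ D Z' y (Y' y)) x :=
    (hcongr (SmoothField.nabla hD.smooth hY hZ) (by
      filter_upwards [hcongr hZ hZZ', hYY'] with y h h'
      rw [nabla_apply, h, h'])).self_of_nhds
  have h2 : D (fun y ↦ D Z y (X y)) x = D (fun y ↦ D Z' y (X' y)) x :=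
    (hcongr (SmoothField.nabla hD.smooth hX hZ) (by
      filter_upwards [hcongr hZ hZZ', hXX'] with y h h'
      rw [nabla_apply, h, h'])).self_of_nhds
  have h3 : VectorField.mlieBracket 𝓘(ℝ, F) X Y x = VectorField.mlieBracket 𝓘(ℝ, F) X' Y' x :=
    Filter.EventuallyEq.mlieBracket_vectorField_eq hXX' hYY'
  rw [curvatureField, curvatureField, h1, h2, h3, (hcongr hZ hZZ').self_of_nhds,
    hXX'.self_of_nhds, hYY'.self_of_nhds]

lemma curvatureField_swap (D : Connection F M) (X Y Z : Π x : M, TangentSpace 𝓘(ℝ, F) x) (x : M) :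
    curvatureField D X Y Z x = -curvatureField D Y X Z x := by
  rw [curvatureField, curvatureField, VectorField.mlieBracket_swap_apply]
  simp only [map_neg]
  abel

lemma curvatureField_add_left (hD : IsLeviCivita D) {X' : Π x : M, TangentSpace 𝓘(ℝ, F) x}
    (hX : SmoothField X) (hX' : SmoothField X') (hZ : SmoothField Z) :
    curvatureField D (X + X') Y Z x = curvatureField D X Y Z x + curvatureField D X' Y Z x := by
  rw [curvatureField_eq, curvatureField_eq, curvatureField_eq, nabla_add_left, nabla_add_left,
    nabla_add (hX.nabla hD.smooth hZ) (hX'.nabla hD.smooth hZ), nabla_apply D (VectorField.mlieBracket _ _ _),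
    VectorField.mlieBracket_add_left (hX.mdiffAt x) (hX'.mdiffAt x)]
  simp only [Pi.add_apply, map_add, ← nabla_apply]
  simp only [nabla_apply]
  abel

lemma curvatureField_smul_left (hD : IsLeviCivita D) (hf : SmoothFun F f)
    (hX : SmoothField X) (hZ : SmoothField Z) :
    curvatureField D (f • X) Y Z x = f x • curvatureField D X Y Z x := by
  rw [curvatureField_eq, curvatureField_eq, nabla_smul_left, nabla_smul_left,
    nabla_smul hf (hX.nabla hD.smooth hZ), nabla_apply D (VectorField.mlieBracket _ _ _),
    VectorField.mlieBracket_smul_left (hf.mdiffAt x) (hX.mdiffAt x)]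
  simp only [Pi.add_apply, Pi.smul_apply', map_add, map_smul, nabla_apply]
  module

lemma curvatureField_add_right (hD : IsLeviCivita D) {Z' : Π x : M, TangentSpace 𝓘(ℝ, F) x}
    (hX : SmoothField X) (hY : SmoothField Y) (hZ : SmoothField Z) (hZ' : SmoothField Z') :
    curvatureField D X Y (Z + Z') x = curvatureField D X Y Z x + curvatureField D X Y Z' x := by
  simp only [curvatureField_eq, nabla_add hZ hZ',
    nabla_add (hX.nabla hD.smooth hZ) (hX.nabla hD.smooth hZ'),
    nabla_add (hY.nabla hD.smooth hZ) (hY.nabla hD.smooth hZ'), Pi.add_apply]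
  abel

/-- The first-order terms in f cancel by symmetry, and the second derivatives X(Yf) - Y(Xf) cancel
against [X, Y]f by `mvfderiv_mlieBracket`. -/
lemma curvatureField_smul_right (hD : IsLeviCivita D) (hf : SmoothFun F f)
    (hX : SmoothField X) (hY : SmoothField Y) (hZ : SmoothField Z) :
    curvatureField D X Y (f • Z) x = f x • curvatureField D X Y Z x := by
  have hfX := hf.mvfderiv_apply hX
  have hfY := hf.mvfderiv_apply hY
  simp only [curvatureField_eq, nabla_smul hf hZ,
    nabla_add ((hX.nabla hD.smooth hZ).smul hf) (hZ.smul hfX),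
    nabla_add ((hY.nabla hD.smooth hZ).smul hf) (hZ.smul hfY),
    nabla_smul hf (hX.nabla hD.smooth hZ), nabla_smul hf (hY.nabla hD.smooth hZ),
    nabla_smul hfX hZ, nabla_smul hfY hZ, Pi.add_apply, Pi.smul_apply',
    ← mvfderiv_mlieBracket hX hY hf x]
  module

/-- The curvature tensor at a point can be computed with arbitrary smooth vector fields. -/
theorem curvature_eq_curvatureField (hD : IsLeviCivita D) (hX : SmoothField X)
    (hY : SmoothField Y) (hZ : SmoothField Z) :
    curvature D x (X x) (Y x) (Z x) = curvatureField D X Y Z x := by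
  obtain ⟨X', hX', hXX', hX'e⟩ := exists_smoothField (X x)
  obtain ⟨Y', hY', hYY', hY'e⟩ := exists_smoothField (Y x)
  obtain ⟨Z', hZ', hZZ', hZ'e⟩ := exists_smoothField (Z x)
  -- Tensoriality in the first slot; antisymmetry will carry it to the second.
  have left : ∀ {U U' V W : Π x : M, TangentSpace 𝓘(ℝ, F) x}, SmoothField U → SmoothField U' →
      SmoothField V → SmoothField W → U x = U' x →
      curvatureField D U V W x = curvatureField D U' V W x := fun hU hU' hV hW h ↦
    eq_of_apply_eq (fun U ↦ curvatureField D U _ _ x)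
      (fun _ _ h1 h2 ↦ curvatureField_add_left hD h1 h2 hW)
      (fun _ _ h1 h2 ↦ curvatureField_smul_left hD h1 h2 hW) hU hU' h
  rw [curvature, ← curvatureField_congr hD hX' hY' hZ' hX'e hY'e hZ'e,
    left hX' hX hY' hZ' hXX', curvatureField_swap, left hY' hY hX hZ' hYY', ← curvatureField_swap]
  exact eq_of_apply_eq (fun U ↦ curvatureField D X Y U x)
    (fun _ _ h1 h2 ↦ curvatureField_add_right hD hX hY h1 h2)
    (fun _ _ h1 h2 ↦ curvatureField_smul_right hD h1 hX hY h2) hZ' hZ hZZ'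

lemma curvature_swap (D : Connection F M) (u v w : TangentSpace 𝓘(ℝ, F) x) :
    curvature D x u v w = -curvature D x v u w :=
  curvatureField_swap ..

lemma curvature_add_left (hD : IsLeviCivita D) (u u' v w : TangentSpace 𝓘(ℝ, F) x) :
    curvature D x (u + u') v w = curvature D x u v w + curvature D x u' v w := by
  obtain ⟨X, hX, rfl, -⟩ := exists_smoothField u
  obtain ⟨X', hX', rfl, -⟩ := exists_smoothField u'
  obtain ⟨Y, hY, rfl, -⟩ := exists_smoothField v
  obtain ⟨Z, hZ, rfl, -⟩ := exists_smoothField w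
  rw [← Pi.add_apply, curvature_eq_curvatureField hD (hX.add hX') hY hZ,
    curvature_eq_curvatureField hD hX hY hZ, curvature_eq_curvatureField hD hX' hY hZ,
    curvatureField_add_left hD hX hX' hZ]

lemma curvature_smul_left (hD : IsLeviCivita D) (a : ℝ) (u v w : TangentSpace 𝓘(ℝ, F) x) :
    curvature D x (a • u) v w = a • curvature D x u v w := by
  obtain ⟨X, hX, rfl, -⟩ := exists_smoothField u
  obtain ⟨Y, hY, rfl, -⟩ := exists_smoothField v
  obtain ⟨Z, hZ, rfl, -⟩ := exists_smoothField w
  have hf : SmoothFun F (fun _ : M ↦ a) := contMDiff_const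
  rw [curvature_eq_curvatureField hD hX hY hZ, ← curvatureField_smul_left hD hf hX hZ,
    ← curvature_eq_curvatureField hD (hX.smul hf) hY hZ]
  rfl

/-- The first Bianchi identity. -/
lemma curvature_bianchi (hD : IsLeviCivita D) (u v w : TangentSpace 𝓘(ℝ, F) x) :
    curvature D x u v w + curvature D x v w u + curvature D x w u v = 0 := by
  obtain ⟨X, hX, rfl, -⟩ := exists_smoothField u
  obtain ⟨Y, hY, rfl, -⟩ := exists_smoothField v
  obtain ⟨Z, hZ, rfl, -⟩ := exists_smoothField w
  have h2 : ∀ {W : Π x : M, TangentSpace 𝓘(ℝ, F) x}, SmoothField W →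
      ContMDiffAt 𝓘(ℝ, F) 𝓘(ℝ, F).tangent (minSmoothness ℝ 2)
        (fun x ↦ (⟨x, W x⟩ : TangentBundle 𝓘(ℝ, F) M)) x := fun hW ↦
    (hW x).of_le (by simpa using (WithTop.coe_le_coe.2 le_top : ((2 : ℕ∞) : ℕ∞ω) ≤ ∞))
  have h3 : IsManifold 𝓘(ℝ, F) (minSmoothness ℝ 3) M :=
    .of_le (n := ∞) (by simpa using (WithTop.coe_le_coe.2 le_top : ((3 : ℕ∞) : ℕ∞ω) ≤ ∞))
  -- Without torsion, [U, V] = ∇_U V - ∇_V U, which turns the Jacobi identity into the Bianchi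
  -- identity.
  have key := VectorField.leibniz_identity_mlieBracket_apply (h2 hX) (h2 hY) (h2 hZ)
  rw [hD.mlieBracket_eq hX (hY.mlieBracket hZ), hD.mlieBracket_eq (hX.mlieBracket hY) hZ,
    hD.mlieBracket_eq hY (hX.mlieBracket hZ)] at key
  have key2 : ∀ {U V W : Π x : M, TangentSpace 𝓘(ℝ, F) x}, SmoothField U → SmoothField V →
      SmoothField W → nabla D U (VectorField.mlieBracket 𝓘(ℝ, F) V W) x
        = nabla D U (nabla D V W) x - nabla D U (nabla D W V) x := fun hU hV hW ↦ by
    rw [hD.mlieBracket_eq hV hW, nabla_sub (hV.nabla hD.smooth hW) (hW.nabla hD.smooth hV)]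
    rfl
  have key3 : ∀ U V W : Π x : M, TangentSpace 𝓘(ℝ, F) x,
      nabla D (VectorField.mlieBracket 𝓘(ℝ, F) U V) W x
        = - nabla D (VectorField.mlieBracket 𝓘(ℝ, F) V U) W x := fun U V W ↦ by
    rw [nabla_apply, VectorField.mlieBracket_swap_apply, map_neg]; rfl
  simp only [Pi.sub_apply, key2 hX hY hZ, key2 hY hX hZ, key2 hZ hX hY] at key
  rw [curvature_eq_curvatureField hD hX hY hZ, curvature_eq_curvatureField hD hY hZ hX,
    curvature_eq_curvatureField hD hZ hX hY]
  simp only [curvatureField_eq]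
  rw [key3 Z X Y]
  linear_combination (norm := module) key

/-- `R(u, v)` is skew-adjoint. -/
lemma inner_curvature_swap (hD : IsLeviCivita D)
    [IsContMDiffRiemannianBundle 𝓘(ℝ, F) ∞ F (fun x : M ↦ TangentSpace 𝓘(ℝ, F) x)]
    (u v w z : TangentSpace 𝓘(ℝ, F) x) :
    (inner ℝ (curvature D x u v w) z : ℝ) = -inner ℝ (curvature D x u v z) w := by
  obtain ⟨X, hX, rfl, -⟩ := exists_smoothField u
  obtain ⟨Y, hY, rfl, -⟩ := exists_smoothField v
  obtain ⟨Z, hZ, rfl, -⟩ := exists_smoothField w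
  obtain ⟨W, hW, rfl, -⟩ := exists_smoothField z
  have h1 : ∀ U : Π x : M, TangentSpace 𝓘(ℝ, F) x,
      (fun y ↦ mvfderiv 𝓘(ℝ, F) (fun y ↦ (inner ℝ (Z y) (W y) : ℝ)) y (U y))
      = fun y ↦ (inner ℝ (nabla D U Z y) (W y) : ℝ) + inner ℝ (Z y) (nabla D U W y) := by
    intro U
    funext y
    exact hD.mvfderiv_inner hZ hW y (U y)
  have h2 : ∀ {U V : Π x : M, TangentSpace 𝓘(ℝ, F) x}, SmoothField U → SmoothField V →
      mvfderiv 𝓘(ℝ, F) (fun y ↦ (inner ℝ (nabla D U Z y) (W y) : ℝ)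
        + inner ℝ (Z y) (nabla D U W y)) x (V x) =
      inner ℝ (nabla D V (nabla D U Z) x) (W x) + inner ℝ (nabla D U Z x) (nabla D V W x)
      + (inner ℝ (nabla D V Z x) (nabla D U W x) + inner ℝ (Z x) (nabla D V (nabla D U W) x)) := by
    intro U V hU hV
    have a := hU.nabla hD.smooth hZ
    have b := hU.nabla hD.smooth hW
    rw [mvfderiv_fun_add ((a.inner hW).mdiffAt x) ((hZ.inner b).mdiffAt x),
      add_apply, hD.mvfderiv_inner a hW, hD.mvfderiv_inner hZ b]
    rfl
  -- The commutator X Y - Y X - [X, Y] annihilates g(Z, W). Expanded by metricity, its mixed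
  -- products cancel and leave g(R(X,Y)Z, W) + g(Z, R(X,Y)W) = 0.
  have key := mvfderiv_mlieBracket hX hY (hZ.inner hW) x
  rw [h1, h1, h2 hX hY, h2 hY hX, hD.mvfderiv_inner hZ hW] at key
  rw [curvature_eq_curvatureField hD hX hY hZ, curvature_eq_curvatureField hD hX hY hW,
    curvatureField_eq, curvatureField_eq]
  simp only [inner_sub_left]
  simp only [← nabla_apply] at key
  rw [real_inner_comm (Z x), real_inner_comm (Z x), real_inner_comm (Z x)]
  linear_combination key

end CurvatureTensor

end Curvature

/-! ### Pointwise linear algebra of Sasakian structures and of curvature tensors. -/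

section Algebra

open scoped InnerProductSpace

variable {V : Type*} [NormedAddCommGroup V] [InnerProductSpace ℝ V]

/-- The linear algebra of a normal contact metric structure at a point: `Q = ∇ξ` and `P = ∇φ` are
determined by the structure tensors. -/
theorem covDeriv_structure_tensors {φ Q : V →ₗ[ℝ] V} {P : V →ₗ[ℝ] V →ₗ[ℝ] V} {ξ : V}
    (hφφ : ∀ v, φ (φ v) = -v + ⟪v, ξ⟫_ℝ • ξ) (hφξ : φ ξ = 0)
    (hφ : ∀ u v, ⟪φ u, v⟫_ℝ = -⟪u, φ v⟫_ℝ) (hQξ : ∀ u, ⟪Q u, ξ⟫_ℝ = 0)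
    (hQ : ∀ u v, ⟪Q u, v⟫_ℝ - ⟪Q v, u⟫_ℝ = 2 * ⟪u, φ v⟫_ℝ)
    (hN : ∀ u v, P (φ u) v - P (φ v) u + φ (P v u) - φ (P u v) = -(2 * ⟪u, φ v⟫_ℝ) • ξ)
    (hcyc : ∀ u v w, ⟪P u v, w⟫_ℝ + ⟪P v w, u⟫_ℝ + ⟪P w u, v⟫_ℝ = 0)
    (hPφ : ∀ u v, P u (φ v) + φ (P u v) = ⟪Q u, v⟫_ℝ • ξ + ⟪v, ξ⟫_ℝ • Q u)
    (hPξ : ∀ u, P u ξ = -φ (Q u)) (hP : ∀ u v w, ⟪P u v, w⟫_ℝ = -⟪P u w, v⟫_ℝ) :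
    (∀ u, Q u = -φ u) ∧ ∀ u v, P u v = ⟪u, v⟫_ℝ • ξ - ⟪v, ξ⟫_ℝ • u := by
  have hφη : ∀ u, ⟪φ u, ξ⟫_ℝ = 0 := fun u ↦ by rw [hφ, hφξ]; simp
  have hφ2 : ∀ u v, ⟪φ u, φ v⟫_ℝ = ⟪u, v⟫_ℝ - ⟪u, ξ⟫_ℝ * ⟪v, ξ⟫_ℝ := fun u v ↦ by
    rw [hφ, hφφ, inner_add_right, inner_neg_right, real_inner_smul_right]; ring
  have hQ0 : Q ξ = 0 := by
    refine ext_inner_right ℝ fun v ↦ ?_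
    have := hQ ξ v
    rw [hQξ, real_inner_comm (φ v) ξ, hφη] at this
    simpa using this
  -- Normality with ξ as second argument, paired with φ v.
  have hPQ : ∀ u v, ⟪P ξ u, v⟫_ℝ = ⟪Q (φ u), v⟫_ℝ + ⟪Q u, φ v⟫_ℝ := fun u v ↦ by
    have h1 := congrArg (fun z ↦ ⟪z, φ v⟫_ℝ) (hN u ξ)
    have h2 : ⟪P ξ u, ξ⟫_ℝ = 0 := by rw [hP, hPξ, hQ0]; simp
    simp only [hPξ, hφξ, map_zero, LinearMap.zero_apply, inner_add_left, inner_sub_left,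
      inner_neg_left, inner_zero_right, mul_zero, neg_zero, zero_smul, inner_zero_left, map_neg,
      hφ2, hφη, h2, hQξ] at h1
    have h3 := hφ (Q u) v
    linarith
  -- The cyclic identity with ξ in the first place says g(Q(φu), v) = -g(Qv, φu), the Killing
  -- property of ξ; combined with the skew part `hQ` it determines Q on the image of φ.
  have hQφ : ∀ u v, ⟪Q (φ u), v⟫_ℝ = ⟪φ u, φ v⟫_ℝ := fun u v ↦ by
    have h1 := hcyc ξ u v
    rw [hPQ, hP u, hPξ, hPξ, inner_neg_left, inner_neg_left, hφ, hφ] at h1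
    have h2 := hQ (φ u) v
    linarith
  have hQ' : ∀ u, Q u = -φ u := fun u ↦ by
    have h1 : u = -φ (φ u) + ⟪u, ξ⟫_ℝ • ξ := by rw [hφφ]; abel
    refine ext_inner_right ℝ fun v ↦ ?_
    conv_lhs => rw [h1]
    rw [map_add, map_smul, hQ0, map_neg, inner_add_left, inner_neg_left, hQφ, hφ2, hφη, hφ]
    simp [hφ]
  refine ⟨hQ', ?_⟩
  have hPξ' : ∀ u w, ⟪P u ξ, w⟫_ℝ = -⟪u, w⟫_ℝ + ⟪u, ξ⟫_ℝ * ⟪w, ξ⟫_ℝ := fun u w ↦ by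
    rw [hPξ, hQ', map_neg, neg_neg, hφφ, inner_add_left, inner_neg_left, real_inner_smul_left,
      real_inner_comm ξ w]
  have hP0 : ∀ u w, ⟪P ξ u, w⟫_ℝ = 0 := fun u w ↦ by
    rw [hPQ, hQφ, hQ', inner_neg_left]; ring
  have hP5 : ∀ u v w, ⟪P u (φ v), w⟫_ℝ
      = ⟪P u v, φ w⟫_ℝ - ⟪φ u, v⟫_ℝ * ⟪w, ξ⟫_ℝ - ⟪v, ξ⟫_ℝ * ⟪φ u, w⟫_ℝ := fun u v w ↦ by
    have h := congrArg (fun z ↦ ⟪z, w⟫_ℝ) (hPφ u v)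
    simp only [inner_add_left, hQ', inner_neg_left, real_inner_smul_left] at h
    rw [hφ (P u v), real_inner_comm w ξ] at h
    linarith
  have hPφφ : ∀ u v w, ⟪P u v, φ (φ w)⟫_ℝ = -⟪P u v, w⟫_ℝ + ⟪w, ξ⟫_ℝ * ⟪P u v, ξ⟫_ℝ :=
    fun u v w ↦ by rw [hφφ, inner_add_right, inner_neg_right, real_inner_smul_right]
  have hPη : ∀ u v, ⟪P u v, ξ⟫_ℝ = ⟪u, v⟫_ℝ - ⟪u, ξ⟫_ℝ * ⟪v, ξ⟫_ℝ := fun u v ↦ by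
    rw [hP, hPξ']; ring
  -- The Koszul-type formula for ∇φ: normality paired with φx, two cyclic identities, and `hP5` to
  -- move φ across P. Inserting φx and φy removes most of the ξ-components.
  have key : ∀ x y z, 2 * ⟪P (φ x) (φ y), z⟫_ℝ = 2 * ⟪φ x, φ y⟫_ℝ * ⟪z, ξ⟫_ℝ := fun x y z ↦ by
    have h1 := congrArg (fun w ↦ ⟪w, φ x⟫_ℝ) (hN y z)
    simp only [inner_add_left, inner_sub_left, hφ2, inner_neg_left, neg_smul,
      real_inner_smul_left, hPη] at h1
    have c1 := hcyc (φ y) z (φ x)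
    have c2 := hcyc (φ z) y (φ x)
    have d1 := hP5 z x (φ y)
    have d2 := hP5 y x (φ z)
    have d3 := hP5 (φ x) y z
    have e1 := hP (φ x) (φ z) y
    rw [hPφφ, hPη, hφη, hφ2] at d1 d2
    rw [hφ (φ x), hφ (φ x), hφ2, hφ2] at d3
    rw [real_inner_comm (φ x) ξ, hφη] at h1
    rw [hφ2]
    rw [real_inner_comm x z] at d1
    rw [real_inner_comm x y] at d2
    linear_combination -h1 + c1 - c2 - d1 + d2 + d3 + e1 + hP z y x - hP y z x
  -- Replacing x by φx recovers every direction, since φ² = -1 modulo ξ and P ξ = 0. The same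
  -- substitution in the second argument, with P u ξ known from `hPξ'`, finishes the proof below.
  have key2 : ∀ x y z, ⟪P x (φ y), z⟫_ℝ = ⟪x, φ y⟫_ℝ * ⟪z, ξ⟫_ℝ := fun x y z ↦ by
    have h := key (φ x) y z
    simp only [hφφ x, map_add, map_neg, map_smul, LinearMap.add_apply, LinearMap.neg_apply,
      LinearMap.smul_apply, inner_add_left, inner_neg_left, real_inner_smul_left, hP0] at h
    rw [real_inner_comm (φ y) ξ, hφη] at h
    linarith
  refine fun u v ↦ ext_inner_right ℝ fun w ↦ ?_
  have h := key2 u (φ v) w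
  simp only [hφφ v, map_add, map_neg, map_smul, inner_add_left, inner_neg_left,
    real_inner_smul_left, hPξ', inner_add_right, inner_neg_right, real_inner_smul_right] at h
  rw [inner_sub_left, real_inner_smul_left, real_inner_smul_left, real_inner_comm w ξ]
  linarith

section Curvature

variable {W : Type*} [AddCommGroup W] {J : W → W} {B : W → W → W → W → ℝ}

/-- The octahedron argument: the four Bianchi identities on u, v, w, z combine, up to the two
antisymmetries, to the exchange of pairs. -/
lemma pair_symm (h12 : ∀ u v w z, B u v w z = -B v u w z) (h34 : ∀ u v w z, B u v w z = -B u v z w)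
    (hb : ∀ u v w z, B u v w z + B v w u z + B w u v z = 0) (u v w z : W) :
    B u v w z = B w z u v := by
  linarith [hb u v w z, hb v w z u, hb w z u v, hb z u v w, h34 u v w z, h34 v w u z, h34 w u v z,
    h34 v w z u, h34 w z v u, h34 z v w u, h34 w z u v, h34 z u w v, h34 u w z v,
    h34 z u v w, h34 u v z w, h34 v z u w, h12 u v z w, h12 v w z u, h12 w u z v, h12 u w z v,
    h12 z u v w, h12 w z u v, h12 u v w z, h12 v z u w, h12 z v w u]

/-- An algebraic curvature tensor that is invariant under a complex structure and has vanishing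
holomorphic sectional curvature has vanishing sectional curvature. -/
theorem curvature_eq_zero_of_holomorphic (hadd : ∀ u u' v w z, B (u + u') v w z
      = B u v w z + B u' v w z)
    (h12 : ∀ u v w z, B u v w z = -B v u w z) (h34 : ∀ u v w z, B u v w z = -B u v z w)
    (hb : ∀ u v w z, B u v w z + B v w u z + B w u v z = 0)
    (hJadd : ∀ u v, J (u + v) = J u + J v) (hJJ : ∀ u, J (J u) = -u)
    (hJ : ∀ u v w z, B u v (J w) (J z) = B u v w z) (hH : ∀ u, B u (J u) (J u) u = 0)
    (u v w : W) : B w u u v = 0 := by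
  have hp := pair_symm h12 h34 hb
  have add2 : ∀ u v v' w z, B u (v + v') w z = B u v w z + B u v' w z := fun u v v' w z ↦ by
    rw [h12, hadd, h12 v, h12 v']; ring
  have add3 : ∀ u v w w' z, B u v (w + w') z = B u v w z + B u v w' z := fun u v w w' z ↦ by
    rw [hp, hadd, hp w, hp w']
  have add4 : ∀ u v w z z', B u v w (z + z') = B u v w z + B u v w z' := fun u v w z z' ↦ by
    rw [h34, add3, h34 u v z, h34 u v z']; ring
  have neg1 : ∀ u v w z, B (-u) v w z = -B u v w z := fun u v w z ↦ by
    have h0 : B (0 + 0) v w z = B 0 v w z + B 0 v w z := hadd 0 0 v w z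
    have h1 := hadd (-u) u v w z
    rw [add_zero] at h0
    rw [neg_add_cancel] at h1
    linarith
  have neg2 : ∀ u v w z, B u (-v) w z = -B u v w z := fun u v w z ↦ by
    rw [h12, neg1, h12 v, neg_neg]
  have neg3 : ∀ u v w z, B u v (-w) z = -B u v w z := fun u v w z ↦ by
    rw [hp, neg1, hp w]
  have neg4 : ∀ u v w z, B u v w (-z) = -B u v w z := fun u v w z ↦ by
    rw [h34, neg3, h34 u v z, neg_neg]
  have Jneg : ∀ u, J (-u) = -J u := fun u ↦ by
    rw [← hJJ u, hJJ (J u)]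
  have hJ' : ∀ u v w z, B (J u) (J v) w z = B u v w z := fun u v w z ↦ by
    rw [hp, hJ, hp]
  -- Polarization of `hH` along u + tv at t = ±1, ±2. Differences at opposite t remove the even
  -- part, and two values of |t| separate the linear coefficient from the cubic one. The linear
  -- coefficient is 4 B(u, Ju, Ju, v). Sums v + v stand for 2v because W is only an additive group.
  have s1 : ∀ u v, B u (J u) (J u) v = 0 := fun u v ↦ by
    have a1 : B v (J u) (J u) u = B u (J u) (J u) v := by
      rw [hp, h12, h34]; ring
    have a2 : B u (J v) (J u) u = B v (J u) (J u) u := by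
      rw [← hJ', hJJ, neg2, h12]; ring
    have a3 : B u (J u) (J v) u = B u (J u) (J u) v := by
      rw [← hJ, hJJ, neg3, h34]; ring
    have p1 := hH (u + v)
    have p2 := hH (u + -v)
    have p3 := hH (u + (v + v))
    have p4 := hH (u + -(v + v))
    simp only [hadd, add2, add3, add4, neg1, neg2, neg3, neg4, hJadd, Jneg] at p1 p2 p3 p4
    linarith
  have s2 : ∀ u v, B u (J u) u v = 0 := fun u v ↦ by
    rw [← hJ, s1]
  -- The part of `s2` linear in w, at u ± w, has three terms. J-invariance turns B(u, Jw, u, v) into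
  -- B(w, Ju, u, v), and Bianchi rewrites B(u, Ju, w, v).
  have s3 : ∀ u v w, 3 * B w (J u) u v = B w u (J u) v := fun u v w ↦ by
    have p1 := s2 (u + w) v
    have a1 := hJ' u (J w) u v
    have a2 := hb u (J u) w v
    rw [hJJ, neg2] at a1
    have p2 := s2 (u + -w) v
    simp only [hadd, add2, add3, neg1, neg2, neg3, hJadd, Jneg, s2] at p1 p2
    linarith [h12 (J u) w u v, h12 w u (J u) v]
  -- With a = B(w, Ju, u, v) and b = B(w, u, Ju, v), `s3` at u and at Ju gives 3a = b and 3b = a, so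
  -- both vanish.
  have s4 : ∀ u v w, B w u (J u) v = 0 := fun u v w ↦ by
    have p1 := s3 u v w
    have p2 := s3 (J u) v w
    rw [hJJ, neg2, neg3] at p2
    linarith
  rw [← hJ]
  exact s4 u (J v) w

end Curvature

/-- The curvature tensor of a Sasakian space form at a point, contracted twice with the same
vector: the linear algebra. -/
theorem curvature_of_phi_sectional {φ : V →ₗ[ℝ] V} {ξ : V} {R : V → V → V → V} {c : ℝ}
    (hφφ : ∀ v, φ (φ v) = -v + ⟪v, ξ⟫_ℝ • ξ) (hξξ : ⟪ξ, ξ⟫_ℝ = 1) (hφη : ∀ u, ⟪φ u, ξ⟫_ℝ = 0)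
    (hφ : ∀ u v, ⟪φ u, v⟫_ℝ = -⟪u, φ v⟫_ℝ)
    (hadd : ∀ u u' v w, R (u + u') v w = R u v w + R u' v w)
    (hsmul : ∀ (a : ℝ) u v w, R (a • u) v w = a • R u v w)
    (h12 : ∀ u v w, R u v w = -R v u w) (hb : ∀ u v w, R u v w + R v w u + R w u v = 0)
    (h34 : ∀ u v w z, ⟪R u v w, z⟫_ℝ = -⟪R u v z, w⟫_ℝ)
    (hRξ : ∀ u v, R u v ξ = ⟪v, ξ⟫_ℝ • u - ⟪u, ξ⟫_ℝ • v)
    (hRφ : ∀ u v w, R u v (φ w) = φ (R u v w) - ⟪v, w⟫_ℝ • φ u + ⟪φ u, w⟫_ℝ • v + ⟪u, w⟫_ℝ • φ v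
      - ⟪φ v, w⟫_ℝ • u)
    (hc : ∀ u, ⟪u, u⟫_ℝ = 1 → ⟪u, ξ⟫_ℝ = 0 → ⟪R u (φ u) (φ u), u⟫_ℝ = c)
    {u v : V} (hu : ⟪u, ξ⟫_ℝ = 0) (hv : ⟪v, ξ⟫_ℝ = 0) :
    R v u u = ((c + 3) / 4) • (⟪u, u⟫_ℝ • v - ⟪u, v⟫_ℝ • u)
      + (3 * ((c - 1) / 4) * ⟪v, φ u⟫_ℝ) • φ u := by
  let W : Submodule ℝ V := LinearMap.ker (innerₗ V ξ)
  have hW : ∀ w : W, ⟪(w : V), ξ⟫_ℝ = 0 := fun w ↦ by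
    rw [real_inner_comm]; exact w.2
  have mem : ∀ {w : V}, ⟪w, ξ⟫_ℝ = 0 → w ∈ W := fun {w} hw ↦ by
    rw [real_inner_comm] at hw; exact hw
  let J : W → W := fun w ↦ ⟨φ w, mem (hφη w)⟩
  -- R minus the model tensor of φ-sectional curvature c, restricted to ξ^⊥. R alone is not
  -- φ-invariant: `hRφ` carries the defect of a curvature-one tensor. The model has the same defect
  -- because its coefficients (c+3)/4 and (c-1)/4 differ by 1.
  let B : W → W → W → W → ℝ := fun u v w z ↦ ⟪R u v w, (z : V)⟫_ℝ
    - ((c + 3) / 4 * (⟪(v : V), w⟫_ℝ * ⟪(u : V), z⟫_ℝ - ⟪(u : V), w⟫_ℝ * ⟪(v : V), z⟫_ℝ)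
    + (c - 1) / 4 * (⟪(u : V), φ w⟫_ℝ * ⟪φ v, (z : V)⟫_ℝ - ⟪(v : V), φ w⟫_ℝ * ⟪φ u, (z : V)⟫_ℝ
      + 2 * ⟪(u : V), φ v⟫_ℝ * ⟪φ w, (z : V)⟫_ℝ))
  have hskew : ∀ a b : V, ⟪a, φ b⟫_ℝ = -⟪b, φ a⟫_ℝ := fun a b ↦ by
    rw [← hφ, real_inner_comm]
  have hφφW : ∀ w : W, φ (φ (w : V)) = -(w : V) := fun w ↦ by rw [hφφ, hW]; simp
  have hB : ∀ u v w : W, B w u u v = 0 := by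
    refine curvature_eq_zero_of_holomorphic (J := J) ?_ ?_ ?_ ?_ ?_ ?_ ?_ ?_
    · intro u u' v w z
      simp only [B, Submodule.coe_add, hadd, inner_add_left, map_add]
      ring
    · intro u v w z
      simp only [B]
      rw [h12, inner_neg_left, hskew u v]
      ring
    · intro u v w z
      simp only [B, hφ]
      rw [h34, hskew w z]
      ring
    · intro u v w z
      have h := congrArg (fun a ↦ ⟪a, (z : V)⟫_ℝ) (hb u v w)
      simp only [inner_add_left, inner_zero_left] at h
      simp only [B]
      rw [hskew (v : V) u, hskew (w : V) u, hskew (w : V) v, real_inner_comm (u : V) v,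
        real_inner_comm (u : V) w, real_inner_comm (v : V) w]
      linear_combination h
    · intro u v
      ext
      simp [J]
    · intro u
      ext
      exact hφφW u
    · intro u v w z
      simp only [B, J, hRφ, inner_add_left, inner_sub_left, real_inner_smul_left, hφ, hφφW,
        inner_neg_right, map_neg, neg_neg]
      ring
    · intro u
      have hR2 : ∀ (a : ℝ) (u v w : V), R u (a • v) w = a • R u v w := fun a u v w ↦ by
        rw [h12, hsmul, h12 v, smul_neg, neg_neg]
      have hR3 : ∀ (a : ℝ) (u v w z : V), ⟪R u v (a • w), z⟫_ℝ = a * ⟪R u v w, z⟫_ℝ :=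
        fun a u v w z ↦ by
          rw [h34, real_inner_smul_right, h34 u v w]; ring
      -- `hc` concerns unit vectors; normalizing u uses that the expression is homogeneous of degree
      -- four.
      have hform : ⟪R (u : V) (φ u) (φ u), (u : V)⟫_ℝ = c * ⟪(u : V), u⟫_ℝ ^ 2 := by
        by_cases h0 : (u : V) = 0
        · simp [h0]
        · have hs : ‖(u : V)‖ ≠ 0 := norm_ne_zero_iff.2 h0
          have h1 := hc (‖(u : V)‖⁻¹ • (u : V))
            (by rw [real_inner_smul_left, real_inner_smul_right, real_inner_self_eq_norm_sq]
                field_simp)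
            (by rw [real_inner_smul_left, hW, mul_zero])
          rw [map_smul, hsmul, hR2, real_inner_smul_left, real_inner_smul_left, hR3,
            real_inner_smul_right] at h1
          rw [real_inner_self_eq_norm_sq, ← h1]
          field_simp
      simp only [B, J, hφφW, hφ, hform, inner_neg_right]
      have h0 : ⟪(u : V), φ u⟫_ℝ = 0 := by linarith [hskew u u]
      rw [h0]
      ring
  have hRz : ⟪R v u u, ξ⟫_ℝ = 0 := by rw [h34, hRξ, hu, hv]; simp
  have hform : ∀ z, ⟪z, ξ⟫_ℝ = 0 → ⟪R v u u, z⟫_ℝ = ⟪((c + 3) / 4) • (⟪u, u⟫_ℝ • v - ⟪u, v⟫_ℝ • u)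
      + (3 * ((c - 1) / 4) * ⟪v, φ u⟫_ℝ) • φ u, z⟫_ℝ := fun z hz ↦ by
    have h := hB ⟨u, mem hu⟩ ⟨z, mem hz⟩ ⟨v, mem hv⟩
    simp only [B] at h
    simp only [inner_add_left, inner_sub_left, real_inner_smul_left]
    rw [real_inner_comm v u]
    have h0 : ⟪u, φ u⟫_ℝ = 0 := by linarith [hskew u u]
    rw [h0] at h
    linear_combination h
  -- Test vectors split along ξ: on ξ^⊥ the identity is B = 0, and along ξ both sides vanish.
  refine ext_inner_right ℝ fun z ↦ ?_
  have hz : z = (z - ⟪z, ξ⟫_ℝ • ξ) + ⟪z, ξ⟫_ℝ • ξ := by abel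
  rw [hz, inner_add_right, inner_add_right, hform _ (by
    rw [inner_sub_left, real_inner_smul_left, hξξ]; ring), real_inner_smul_right, hRz]
  simp [inner_add_left, inner_sub_left, real_inner_smul_left, real_inner_smul_right, hu, hv, hφη]

end Algebra

/-! ### The covariant derivatives of ξ and φ on a Sasakian manifold. -/

section Structure

variable {F : Type*} [NormedAddCommGroup F] [NormedSpace ℝ F] [FiniteDimensional ℝ F]
  {M : Type*} [TopologicalSpace M] [ChartedSpace F M] [IsManifold 𝓘(ℝ, F) ∞ M] [T2Space M]
  {x : M}

/-- A `C^∞`-linear map on smooth vector fields with scalars evaluated at `x` is induced by a linear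
map on the tangent space at `x`. -/
lemma exists_linearMap_of_tensorial {A : Type*} [AddCommGroup A] [Module ℝ A]
    (Φ : (Π y : M, TangentSpace 𝓘(ℝ, F) y) → A)
    (hadd : ∀ X Y, SmoothField X → SmoothField Y → Φ (X + Y) = Φ X + Φ Y)
    (hsmul : ∀ f X, SmoothFun F f → SmoothField X → Φ (f • X) = f x • Φ X) :
    ∃ L : TangentSpace 𝓘(ℝ, F) x →ₗ[ℝ] A, ∀ X, SmoothField X → L (X x) = Φ X := by
  choose E hE hEx _ using fun u : TangentSpace 𝓘(ℝ, F) x ↦ exists_smoothField u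
  refine ⟨{ toFun := fun u ↦ Φ (E u), map_add' := fun u v ↦ ?_, map_smul' := fun a u ↦ ?_ },
    fun X hX ↦ eq_of_apply_eq Φ hadd hsmul (hE _) hX (hEx _)⟩
  · rw [← hadd _ _ (hE u) (hE v)]
    exact eq_of_apply_eq Φ hadd hsmul (hE _) ((hE u).add (hE v)) (by simp [hEx])
  · have hf : SmoothFun F (fun _ : M ↦ a) := contMDiff_const
    rw [RingHom.id_apply, ← hsmul _ _ hf (hE u)]
    exact eq_of_apply_eq Φ hadd hsmul (hE _) ((hE u).smul hf) (by simp [hEx])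

variable [RiemannianBundle (fun x : M ↦ TangentSpace 𝓘(ℝ, F) x)]

namespace AlmostContactMetric

variable (S : AlmostContactMetric F M) (u v : TangentSpace 𝓘(ℝ, F) x)

/-- Computing φ³ in two ways gives η(u) φξ = η(φu) ξ, so φξ is a multiple of ξ; since φ²ξ = 0,
either that multiple or φξ itself is zero. -/
lemma φ_ξ (x : M) : S.φ x (S.ξ x) = 0 := by
  have h1 : ∀ u : TangentSpace 𝓘(ℝ, F) x, S.η x u • S.φ x (S.ξ x) = S.η x (S.φ x u) • S.ξ x := by
    intro u
    have h := congrArg (S.φ x) (S.φ_φ x u)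
    rw [S.φ_φ, map_add, map_neg, map_smul] at h
    simpa using h.symm
  have h2 := h1 (S.ξ x)
  have h3 := S.φ_φ x (S.ξ x)
  rw [S.η_ξ, one_smul] at h2
  rw [S.η_ξ, one_smul, neg_add_cancel] at h3
  have h4 := congrArg (S.φ x) h2
  rw [h3, map_smul] at h4
  rcases smul_eq_zero.1 h4.symm with h | h
  · rw [h2, h, zero_smul]
  · exact h

lemma η_φ : S.η x (S.φ x u) = 0 := by
  have h := congrArg (S.φ x) (S.φ_φ x u)
  rw [S.φ_φ, map_add, map_neg, map_smul, S.φ_ξ, smul_zero] at h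
  have h2 := congrArg (S.η x) h
  simpa [S.η_ξ] using h2

lemma η_eq_inner : S.η x u = inner ℝ u (S.ξ x) := by
  have h := S.inner_φ_φ x u (S.ξ x)
  rw [S.φ_ξ, inner_zero_right, S.η_ξ] at h
  linarith

lemma inner_ξ_ξ (x : M) : (inner ℝ (S.ξ x) (S.ξ x) : ℝ) = 1 := by
  rw [← S.η_eq_inner, S.η_ξ]

lemma inner_φ_ξ : (inner ℝ (S.φ x u) (S.ξ x) : ℝ) = 0 := by
  rw [← S.η_eq_inner, S.η_φ]

lemma φ_φ_inner : S.φ x (S.φ x u) = -u + (inner ℝ u (S.ξ x) : ℝ) • S.ξ x := by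
  rw [S.φ_φ, S.η_eq_inner]

lemma inner_φ_left : (inner ℝ (S.φ x u) v : ℝ) = -inner ℝ u (S.φ x v) := by
  have h := S.inner_φ_φ x u (S.φ x v)
  rw [S.φ_φ_inner, inner_add_right, inner_neg_right, real_inner_smul_right, S.inner_φ_ξ,
    S.η_φ] at h
  linarith

/-- The vector field `φ X`. -/
def φField (X : Π x : M, TangentSpace 𝓘(ℝ, F) x) : Π x : M, TangentSpace 𝓘(ℝ, F) x :=
  fun x ↦ S.φ x (X x)

lemma φField_apply (X : Π x : M, TangentSpace 𝓘(ℝ, F) x) (x : M) :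
    S.φField X x = S.φ x (X x) := rfl

variable {S} {X Y Z : Π x : M, TangentSpace 𝓘(ℝ, F) x} {f : M → ℝ} {D : Connection F M}

lemma smoothField_ξ : SmoothField S.ξ := S.smooth_ξ

lemma smoothField_φField (hX : SmoothField X) : SmoothField (S.φField X) :=
  ContMDiff.clm_bundle_apply (n := ∞) (F₁ := F) (F₂ := F)
    (E₁ := fun x : M ↦ TangentSpace 𝓘(ℝ, F) x) (E₂ := fun x : M ↦ TangentSpace 𝓘(ℝ, F) x)
    S.smooth_φ hX

lemma φField_add : S.φField (X + Y) = S.φField X + S.φField Y := by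
  funext x; simp [φField]

lemma φField_smul : S.φField (f • X) = f • S.φField X := by
  funext x; simp [φField]

variable [IsContMDiffRiemannianBundle 𝓘(ℝ, F) ∞ F (fun x : M ↦ TangentSpace 𝓘(ℝ, F) x)]

/-- The tensor ∇φ at x: the derivatives of f cancel between the two Leibniz rules. It supplies the P
of `covDeriv_structure_tensors`. -/
lemma exists_covDeriv_φ (S : AlmostContactMetric F M) (D : Connection F M) (x : M) :
    ∃ P : TangentSpace 𝓘(ℝ, F) x →ₗ[ℝ] TangentSpace 𝓘(ℝ, F) x →ₗ[ℝ] TangentSpace 𝓘(ℝ, F) x,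
      ∀ u Y, SmoothField Y → P u (Y x) = D (S.φField Y) x u - S.φ x (D Y x u) := by
  obtain ⟨L, hL⟩ := exists_linearMap_of_tensorial (F := F) (x := x)
    (A := TangentSpace 𝓘(ℝ, F) x →ₗ[ℝ] TangentSpace 𝓘(ℝ, F) x)
    (fun Y ↦ (D (S.φField Y) x - S.φ x ∘L D Y x :
      TangentSpace 𝓘(ℝ, F) x →L[ℝ] TangentSpace 𝓘(ℝ, F) x).toLinearMap)
    (fun Y Z hY hZ ↦ by
      ext u
      simp [φField_add, D.isCovariantDerivativeOn.add (hY.mdiffAt x) (hZ.mdiffAt x),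
        D.isCovariantDerivativeOn.add ((smoothField_φField (S := S) hY).mdiffAt x)
          ((smoothField_φField (S := S) hZ).mdiffAt x)]
      abel)
    (fun f Y hf hY ↦ by
      ext u
      simp [φField_smul, D.isCovariantDerivativeOn.leibniz (hY.mdiffAt x) (hf.mdiffAt x),
        D.isCovariantDerivativeOn.leibniz ((smoothField_φField (S := S) hY).mdiffAt x)
          (hf.mdiffAt x), φField_apply]
      module)
  refine ⟨L.flip, fun u Y hY ↦ ?_⟩
  rw [LinearMap.flip_apply, hL Y hY]
  rfl

/-- With a torsion-free metric connection, dη is the skew part of ∇ξ; the derivatives of the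
arguments X and Y drop out. -/
lemma two_mul_dη (hD : IsLeviCivita D) (hX : SmoothField X) (hY : SmoothField Y) (x : M) :
    2 * S.dη X Y x = inner ℝ (D S.ξ x (X x)) (Y x) - inner ℝ (D S.ξ x (Y x)) (X x) := by
  have hη : ∀ Z : Π x : M, TangentSpace 𝓘(ℝ, F) x,
      (fun y ↦ S.η y (Z y)) = fun y ↦ (inner ℝ (Z y) (S.ξ y) : ℝ) := fun Z ↦
    funext fun y ↦ S.η_eq_inner (Z y)
  rw [dη, hη, hη, hD.mvfderiv_inner hY smoothField_ξ, hD.mvfderiv_inner hX smoothField_ξ,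
    S.η_eq_inner, hD.mlieBracket_eq hX hY, Pi.sub_apply, nabla_apply, nabla_apply, inner_sub_left,
    real_inner_comm (D S.ξ x (X x)), real_inner_comm (D S.ξ x (Y x))]
  ring

lemma IsSasakian.inner_covDeriv_ξ_sub (hS : S.IsSasakian) (hD : IsLeviCivita D)
    (u v : TangentSpace 𝓘(ℝ, F) x) :
    (inner ℝ (D S.ξ x u) v - inner ℝ (D S.ξ x v) u : ℝ) = 2 * inner ℝ u (S.φ x v) := by
  obtain ⟨X, hX, rfl, -⟩ := exists_smoothField u
  obtain ⟨Y, hY, rfl, -⟩ := exists_smoothField v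
  rw [← two_mul_dη hD hX hY, hS.contact X Y x (hX.mdiffAt x) (hY.mdiffAt x)]

lemma inner_covDeriv_ξ_ξ (hD : IsLeviCivita D) (u : TangentSpace 𝓘(ℝ, F) x) :
    (inner ℝ (D S.ξ x u) (S.ξ x) : ℝ) = 0 := by
  have h := hD.mvfderiv_inner (smoothField_ξ (S := S)) (smoothField_ξ (S := S)) x u
  simp only [inner_ξ_ξ, mvfderiv_const, zero_apply] at h
  rw [real_inner_comm (D S.ξ x u)] at h
  linarith

lemma inner_covDeriv_φ_swap (hD : IsLeviCivita D) (hY : SmoothField Y) (hZ : SmoothField Z)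
    (u : TangentSpace 𝓘(ℝ, F) x) :
    (inner ℝ (D (S.φField Y) x u - S.φ x (D Y x u)) (Z x) : ℝ)
      = -inner ℝ (D (S.φField Z) x u - S.φ x (D Z x u)) (Y x) := by
  have h1 := hD.mvfderiv_inner (smoothField_φField (S := S) hY) hZ x u
  have h2 := hD.mvfderiv_inner hY (smoothField_φField (S := S) hZ) x u
  have h3 : (fun y ↦ (inner ℝ (S.φField Y y) (Z y) : ℝ))
      = fun y ↦ -inner ℝ (Y y) (S.φField Z y) := funext fun y ↦ S.inner_φ_left _ _
  rw [h3, mvfderiv_fun_neg, neg_apply, h2, φField_apply, φField_apply] at h1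
  have h4 := S.inner_φ_left (D Y x u) (Z x)
  have h5 := S.inner_φ_left (D Z x u) (Y x)
  rw [inner_sub_left, inner_sub_left, h4, h5, real_inner_comm (Y x) (D (S.φField Z) x u)]
  rw [real_inner_comm (S.φ x (Y x)) (D Z x u)]
  linarith

lemma covDeriv_φ_φ (hD : IsLeviCivita D) (hY : SmoothField Y) (u : TangentSpace 𝓘(ℝ, F) x) :
    D (S.φField (S.φField Y)) x u = -D Y x u
      + ((inner ℝ (D Y x u) (S.ξ x) : ℝ) + inner ℝ (Y x) (D S.ξ x u)) • S.ξ x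
      + (inner ℝ (Y x) (S.ξ x) : ℝ) • D S.ξ x u := by
  have h : S.φField (S.φField Y) = (-1 : ℝ) • Y + (fun y ↦ (inner ℝ (Y y) (S.ξ y) : ℝ)) • S.ξ := by
    funext y
    simp [φField_apply, S.φ_φ_inner]
  have hξ := smoothField_ξ (S := S)
  rw [h, D.isCovariantDerivativeOn.add ((hY.const_smul _).mdiffAt x)
    ((hξ.smul (hY.inner hξ)).mdiffAt x), D.isCovariantDerivativeOn.smul_const _ (hY.mdiffAt x),
    D.isCovariantDerivativeOn.leibniz (hξ.mdiffAt x) ((hY.inner hξ).mdiffAt x)]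
  simp only [add_apply, smul_apply, ContinuousLinearMap.smulRight_apply,
    hD.mvfderiv_inner hY hξ]
  module

/-- The derivative along Z of `inner_covDeriv_ξ_sub`. In the cyclic sum the second derivatives of ξ
assemble into curvatures applied to ξ, which the Bianchi identity kills. This plays the role of
d(dη) = 0. -/
lemma IsSasakian.cyclic_covDeriv_φ (hS : S.IsSasakian) (hD : IsLeviCivita D)
    (hX : SmoothField X) (hY : SmoothField Y) (Z : Π x : M, TangentSpace 𝓘(ℝ, F) x) (x : M) :
    2 * (inner ℝ (D (S.φField Y) x (Z x) - S.φ x (D Y x (Z x))) (X x) : ℝ)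
      = inner ℝ (nabla D Z (nabla D X S.ξ) x - D S.ξ x (D X x (Z x))) (Y x)
      - inner ℝ (nabla D Z (nabla D Y S.ξ) x - D S.ξ x (D Y x (Z x))) (X x) := by
  have hξ := smoothField_ξ (S := S)
  have a := hX.nabla hD.smooth hξ
  have b := hY.nabla hD.smooth hξ
  have h1 : (fun y ↦ (inner ℝ (nabla D X S.ξ y) (Y y) - inner ℝ (nabla D Y S.ξ y) (X y) : ℝ))
      = fun y ↦ 2 * inner ℝ (X y) (S.φField Y y) :=
    funext fun y ↦ hS.inner_covDeriv_ξ_sub hD (X y) (Y y)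
  have h2 := congrArg (fun g ↦ mvfderiv 𝓘(ℝ, F) g x (Z x)) h1
  have hc : SmoothFun F (fun _ : M ↦ (2 : ℝ)) := contMDiff_const
  have hφ := smoothField_φField (S := S) hY
  rw [mvfderiv_fun_sub ((a.inner hY).mdiffAt x) ((b.inner hX).mdiffAt x),
    mvfderiv_fun_mul (hc.mdiffAt x) ((hX.inner hφ).mdiffAt x)] at h2
  simp only [sub_apply, smul_apply, hD.mvfderiv_inner a hY, hD.mvfderiv_inner b hX,
    hD.mvfderiv_inner hX hφ, mvfderiv_const, smul_zero, add_zero, smul_eq_mul] at h2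
  have h3 := hS.inner_covDeriv_ξ_sub hD (D X x (Z x)) (Y x)
  have h4 := hS.inner_covDeriv_ξ_sub hD (X x) (D Y x (Z x))
  simp only [inner_sub_left]
  rw [real_inner_comm (X x) (S.φ x _), real_inner_comm (X x) (D (S.φField Y) x (Z x))]
  simp only [nabla_apply, φField_apply] at h2 ⊢
  linarith

/-- On a Sasakian manifold `∇_u ξ = -φ u` and `(∇_u φ) Y = g(u, Y) ξ - η(Y) u`. -/
theorem IsSasakian.covDeriv (hS : S.IsSasakian) (hD : IsLeviCivita D) (x : M) :
    (∀ u, D S.ξ x u = -S.φ x u) ∧ ∀ u Y, SmoothField Y →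
      D (S.φField Y) x u = S.φ x (D Y x u) + (inner ℝ u (Y x) : ℝ) • S.ξ x
        - (inner ℝ (Y x) (S.ξ x) : ℝ) • u := by
  obtain ⟨P, hP⟩ := exists_covDeriv_φ S D x
  have hξ := smoothField_ξ (S := S)
  have key := covDeriv_structure_tensors (φ := (S.φ x).toLinearMap) (Q := (D S.ξ x).toLinearMap)
    (P := P) (ξ := S.ξ x) (fun v ↦ S.φ_φ_inner v) (S.φ_ξ x) (fun u v ↦ S.inner_φ_left u v)
    (fun u ↦ inner_covDeriv_ξ_ξ hD u) (fun u v ↦ hS.inner_covDeriv_ξ_sub hD u v)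
    -- Normality, with every bracket replaced by covariant derivatives; the derivatives of X and Y
    -- themselves cancel, leaving ∇φ.
    (fun u v ↦ by
      obtain ⟨X, hX, rfl, -⟩ := exists_smoothField u
      obtain ⟨Y, hY, rfl, -⟩ := exists_smoothField v
      have h := hS.normal X Y x (hX.mdiffAt x) (hY.mdiffAt x)
      rw [hS.contact X Y x (hX.mdiffAt x) (hY.mdiffAt x), nijenhuis] at h
      have hφX := smoothField_φField (S := S) hX
      have hφY := smoothField_φField (S := S) hY
      change S.φ x (S.φ x (VectorField.mlieBracket 𝓘(ℝ, F) X Y x))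
        + VectorField.mlieBracket 𝓘(ℝ, F) (S.φField X) (S.φField Y) x
        - S.φ x (VectorField.mlieBracket 𝓘(ℝ, F) (S.φField X) Y x)
        - S.φ x (VectorField.mlieBracket 𝓘(ℝ, F) X (S.φField Y) x) = _ at h
      rw [hD.mlieBracket_eq hX hY, hD.mlieBracket_eq hφX hφY, hD.mlieBracket_eq hφX hY,
        hD.mlieBracket_eq hX hφY] at h
      rw [hP _ Y hY, hP _ X hX, hP _ X hX, hP _ Y hY]
      refine Eq.trans ?_ h
      simp only [Pi.sub_apply, nabla_apply, map_sub, φField_apply, ContinuousLinearMap.coe_coe]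
      abel)
    -- Closedness of the fundamental form, from three instances of `cyclic_covDeriv_φ` and the
    -- Bianchi identity paired with ξ.
    (fun u v w ↦ by
      obtain ⟨X, hX, rfl, -⟩ := exists_smoothField u
      obtain ⟨Y, hY, rfl, -⟩ := exists_smoothField v
      obtain ⟨Z, hZ, rfl, -⟩ := exists_smoothField w
      have h1 := hS.cyclic_covDeriv_φ hD hZ hY X x
      have h2 := hS.cyclic_covDeriv_φ hD hX hZ Y x
      have h3 := hS.cyclic_covDeriv_φ hD hY hX Z x
      have hb := congrArg (fun a ↦ (inner ℝ a (S.ξ x) : ℝ)) (curvature_bianchi hD (X x) (Y x) (Z x))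
      simp only [inner_add_left, inner_zero_left] at hb
      rw [inner_curvature_swap hD, inner_curvature_swap hD (Y x), inner_curvature_swap hD (Z x),
        curvature_eq_curvatureField hD hX hY hξ, curvature_eq_curvatureField hD hY hZ hξ,
        curvature_eq_curvatureField hD hZ hX hξ] at hb
      simp only [curvatureField_eq, hD.mlieBracket_eq hX hY, hD.mlieBracket_eq hY hZ,
        hD.mlieBracket_eq hZ hX, nabla_sub_left, Pi.sub_apply, inner_sub_left] at hb
      rw [hP _ Y hY, hP _ Z hZ, hP _ X hX]
      simp only [inner_sub_left, nabla_apply] at h1 h2 h3 hb ⊢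
      linarith)
    (fun u v ↦ by
      obtain ⟨Y, hY, rfl, -⟩ := exists_smoothField v
      have h := hP u (S.φField Y) (smoothField_φField hY)
      rw [covDeriv_φ_φ hD hY, φField_apply] at h
      rw [ContinuousLinearMap.coe_coe, h, hP u Y hY, map_sub, S.φ_φ_inner,
        real_inner_comm (D S.ξ x u)]
      module)
    (fun u ↦ by
      rw [hP u S.ξ hξ]
      have h : S.φField S.ξ = 0 := funext fun y ↦ S.φ_ξ y
      rw [h, D.isCovariantDerivativeOn.zero]
      simp)
    (fun u v w ↦ by
      obtain ⟨Y, hY, rfl, -⟩ := exists_smoothField v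
      obtain ⟨Z, hZ, rfl, -⟩ := exists_smoothField w
      rw [hP u Y hY, hP u Z hZ, inner_covDeriv_φ_swap hD hY hZ])
  refine ⟨key.1, fun u Y hY ↦ ?_⟩
  have h := key.2 u (Y x)
  rw [hP u Y hY] at h
  rw [add_sub_assoc, ← h]
  abel

end AlmostContactMetric

end Structure

/-! ### Curvature identities of Sasakian manifolds and space forms. -/

section SpaceForm

variable {F : Type*} [NormedAddCommGroup F] [NormedSpace ℝ F] [FiniteDimensional ℝ F]
  {M : Type*} [TopologicalSpace M] [ChartedSpace F M] [IsManifold 𝓘(ℝ, F) ∞ M] [T2Space M]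
  {x : M} [RiemannianBundle (fun x : M ↦ TangentSpace 𝓘(ℝ, F) x)]
  [IsContMDiffRiemannianBundle 𝓘(ℝ, F) ∞ F (fun x : M ↦ TangentSpace 𝓘(ℝ, F) x)]
  {S : AlmostContactMetric F M} {D : Connection F M} {c : ℝ}
  {X Y Z : Π x : M, TangentSpace 𝓘(ℝ, F) x}

namespace AlmostContactMetric

lemma IsSasakian.nabla_ξ (hS : S.IsSasakian) (hD : IsLeviCivita D)
    (X : Π x : M, TangentSpace 𝓘(ℝ, F) x) : nabla D X S.ξ = (-1 : ℝ) • S.φField X := by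
  funext x
  simp [nabla_apply, (hS.covDeriv hD x).1, φField_apply]

lemma IsSasakian.nabla_φField (hS : S.IsSasakian) (hD : IsLeviCivita D)
    (X : Π x : M, TangentSpace 𝓘(ℝ, F) x) (hY : SmoothField Y) :
    nabla D X (S.φField Y) = S.φField (nabla D X Y)
      + ((fun x ↦ (inner ℝ (X x) (Y x) : ℝ)) • S.ξ - (fun x ↦ (inner ℝ (Y x) (S.ξ x) : ℝ)) • X) := by
  funext x
  rw [nabla_apply, (hS.covDeriv hD x).2 _ Y hY]
  simp only [Pi.add_apply, Pi.sub_apply, Pi.smul_apply', φField_apply, nabla_apply]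
  abel

/-- Differentiating ∇ξ = -φ again leaves only ∇φ, which is algebraic. -/
lemma IsSasakian.curvature_ξ (hS : S.IsSasakian) (hD : IsLeviCivita D)
    (u v : TangentSpace 𝓘(ℝ, F) x) :
    curvature D x u v (S.ξ x)
      = (inner ℝ v (S.ξ x) : ℝ) • u - (inner ℝ u (S.ξ x) : ℝ) • v := by
  obtain ⟨X, hX, rfl, -⟩ := exists_smoothField u
  obtain ⟨Y, hY, rfl, -⟩ := exists_smoothField v
  rw [curvature_eq_curvatureField hD hX hY smoothField_ξ, curvatureField_eq, hS.nabla_ξ hD,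
    hS.nabla_ξ hD, hS.nabla_ξ hD, nabla_const_smul _ (smoothField_φField hX),
    nabla_const_smul _ (smoothField_φField hY), hS.nabla_φField hD _ hX, hS.nabla_φField hD _ hY,
    hD.mlieBracket_eq hX hY]
  simp only [Pi.add_apply, Pi.sub_apply, Pi.smul_apply, Pi.smul_apply', φField_apply, map_sub,
    real_inner_comm (X x) (Y x)]
  module

lemma IsSasakian.nabla_nabla_φField (hS : S.IsSasakian) (hD : IsLeviCivita D)
    (X : Π x : M, TangentSpace 𝓘(ℝ, F) x) (hY : SmoothField Y) (hZ : SmoothField Z) (x : M) :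
    nabla D X (nabla D Y (S.φField Z)) x = S.φ x (nabla D X (nabla D Y Z) x)
      + (inner ℝ (X x) (nabla D Y Z x) : ℝ) • S.ξ x - (inner ℝ (nabla D Y Z x) (S.ξ x) : ℝ) • X x
      + ((inner ℝ (nabla D X Y x) (Z x) : ℝ) + inner ℝ (Y x) (nabla D X Z x)) • S.ξ x
      - (inner ℝ (Y x) (Z x) : ℝ) • S.φ x (X x)
      - ((inner ℝ (nabla D X Z x) (S.ξ x) : ℝ) - inner ℝ (Z x) (S.φ x (X x))) • Y x
      - (inner ℝ (Z x) (S.ξ x) : ℝ) • nabla D X Y x := by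
  have hξ := smoothField_ξ (S := S)
  have hYZ := hY.nabla hD.smooth hZ
  have a1 := hξ.smul (hY.inner hZ)
  have a2 := hY.smul (hZ.inner hξ)
  rw [hS.nabla_φField hD _ hZ, nabla_add (smoothField_φField hYZ) (a1.sub a2), nabla_sub a1 a2,
    hS.nabla_φField hD _ hYZ, nabla_smul (hY.inner hZ) hξ, nabla_smul (hZ.inner hξ) hY,
    hS.nabla_ξ hD]
  simp only [Pi.add_apply, Pi.sub_apply, Pi.smul_apply, Pi.smul_apply', φField_apply,
    hD.mvfderiv_inner hY hZ, hD.mvfderiv_inner hZ hξ, ← nabla_apply,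
    hS.nabla_ξ hD, real_inner_smul_right]
  module

/-- The Ricci identity for φ: antisymmetrizing `nabla_nabla_φField` in X and Y cancels every term
that contains a derivative of the arguments, except the one that builds R. -/
lemma IsSasakian.curvature_φ (hS : S.IsSasakian) (hD : IsLeviCivita D)
    (u v w : TangentSpace 𝓘(ℝ, F) x) :
    curvature D x u v (S.φ x w) = S.φ x (curvature D x u v w) - (inner ℝ v w : ℝ) • S.φ x u
      + (inner ℝ (S.φ x u) w : ℝ) • v + (inner ℝ u w : ℝ) • S.φ x v
      - (inner ℝ (S.φ x v) w : ℝ) • u := by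
  obtain ⟨X, hX, rfl, -⟩ := exists_smoothField u
  obtain ⟨Y, hY, rfl, -⟩ := exists_smoothField v
  obtain ⟨Z, hZ, rfl, -⟩ := exists_smoothField w
  have h := curvature_eq_curvatureField (x := x) hD hX hY (smoothField_φField (S := S) hZ)
  rw [φField_apply] at h
  rw [h, curvature_eq_curvatureField hD hX hY hZ, curvatureField_eq, curvatureField_eq,
    hS.nabla_nabla_φField hD X hY hZ, hS.nabla_nabla_φField hD Y hX hZ, hS.nabla_φField hD _ hZ,
    hD.mlieBracket_eq hX hY, nabla_sub_left]
  simp only [Pi.add_apply, Pi.sub_apply, Pi.smul_apply', φField_apply, map_sub, inner_sub_left,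
    real_inner_comm (S.φ x (X x)) (Z x), real_inner_comm (S.φ x (Y x)) (Z x)]
  module

/-- The curvature operator `v ↦ R(v, u)u` of a Sasakian space form on the contact distribution. -/
theorem IsSasakianSpaceForm.curvature_eq (hS : S.IsSasakianSpaceForm D c) (hD : IsLeviCivita D)
    {u v : TangentSpace 𝓘(ℝ, F) x} (hu : (inner ℝ u (S.ξ x) : ℝ) = 0)
    (hv : (inner ℝ v (S.ξ x) : ℝ) = 0) :
    curvature D x v u u = ((c + 3) / 4) • ((inner ℝ u u : ℝ) • v - (inner ℝ u v : ℝ) • u)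
      + (3 * ((c - 1) / 4) * (inner ℝ v (S.φ x u) : ℝ)) • S.φ x u :=
  curvature_of_phi_sectional (φ := (S.φ x).toLinearMap) (ξ := S.ξ x) (R := curvature D x)
    (fun v ↦ S.φ_φ_inner v) (S.inner_ξ_ξ x) (fun u ↦ S.inner_φ_ξ u) (fun u v ↦ S.inner_φ_left u v)
    (fun u u' v w ↦ curvature_add_left hD u u' v w) (fun a u v w ↦ curvature_smul_left hD a u v w)
    (fun u v w ↦ curvature_swap D u v w) (fun u v w ↦ curvature_bianchi hD u v w)
    (fun u v w z ↦ inner_curvature_swap hD u v w z) (fun u v ↦ hS.sasakian.curvature_ξ hD u v)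
    (fun u v w ↦ hS.sasakian.curvature_φ hD u v w) (fun u h h' ↦ hS.phi_sectional x u h h') hu hv

end AlmostContactMetric

end SpaceForm

/-! ### The covariant derivative along a curve. -/

section Along

variable {F : Type*} [NormedAddCommGroup F] [NormedSpace ℝ F] [FiniteDimensional ℝ F]
  {M : Type*} [TopologicalSpace M] [ChartedSpace F M] [IsManifold 𝓘(ℝ, F) ∞ M]
  {D : Connection F M} {γ : ℝ → M} {V W : Π t : ℝ, TangentSpace 𝓘(ℝ, F) (γ t)} {f : ℝ → ℝ} {t : ℝ}

/-- The vector field `V` along the curve `γ` is differentiable at `t`. -/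
def DiffAlong (γ : ℝ → M) (V : Π t : ℝ, TangentSpace 𝓘(ℝ, F) (γ t)) (t : ℝ) : Prop :=
  MDifferentiableAt 𝓘(ℝ, ℝ) 𝓘(ℝ, F).tangent (fun s ↦ (⟨γ s, V s⟩ : TangentBundle 𝓘(ℝ, F) M)) t

/-- The components at time `s`, in the chart at `γ t`, of a vector field along `γ`. -/
def coordAlong (γ : ℝ → M) (V : Π t : ℝ, TangentSpace 𝓘(ℝ, F) (γ t)) (t s : ℝ) : F :=
  ((trivializationAt F (fun x : M ↦ TangentSpace 𝓘(ℝ, F) x) (γ t)) ⟨γ s, V s⟩).2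

lemma diffAlong_iff : DiffAlong γ V t ↔ MDifferentiableAt 𝓘(ℝ, ℝ) 𝓘(ℝ, F) γ t ∧
    DifferentiableAt ℝ (coordAlong γ V t) t := by
  rw [← mdifferentiableAt_iff_differentiableAt]
  exact mdifferentiableAt_totalSpace ..

lemma DiffAlong.curve (h : DiffAlong γ V t) : MDifferentiableAt 𝓘(ℝ, ℝ) 𝓘(ℝ, F) γ t :=
  (diffAlong_iff.1 h).1

lemma DiffAlong.coord (h : DiffAlong γ V t) : DifferentiableAt ℝ (coordAlong γ V t) t :=
  (diffAlong_iff.1 h).2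

lemma DiffAlong.congr (h : DiffAlong γ V t) (hVW : ∀ᶠ s in 𝓝 t, V s = W s) : DiffAlong γ W t :=
  MDifferentiableAt.congr_of_eventuallyEq h (by
    filter_upwards [hVW] with s hs
    rw [hs])

lemma covDerivAlong_congr (hVW : ∀ᶠ s in 𝓝 t, V s = W s) :
    covDerivAlong D γ V t = covDerivAlong D γ W t := by
  have h : (fun s : ℝ ↦ ((trivializationAt F (fun x : M ↦ TangentSpace 𝓘(ℝ, F) x) (γ t))
      ⟨γ s, V s⟩).2) =ᶠ[𝓝 t] fun s : ℝ ↦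
      ((trivializationAt F (fun x : M ↦ TangentSpace 𝓘(ℝ, F) x) (γ t)) ⟨γ s, W s⟩).2 := by
    filter_upwards [hVW] with s hs
    rw [hs]
  rw [covDerivAlong, covDerivAlong, h.deriv_eq, hVW.self_of_nhds]

lemma eventually_mem_baseSet (hγ : MDifferentiableAt 𝓘(ℝ, ℝ) 𝓘(ℝ, F) γ t) :
    ∀ᶠ s in 𝓝 t, γ s ∈
      (trivializationAt F (fun x : M ↦ TangentSpace 𝓘(ℝ, F) x) (γ t)).baseSet :=
  hγ.continuousAt.eventually_mem ((Trivialization.open_baseSet _).mem_nhds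
    (FiberBundle.mem_baseSet_trivializationAt F _ _))

lemma coordAlong_add (hγ : MDifferentiableAt 𝓘(ℝ, ℝ) 𝓘(ℝ, F) γ t) :
    coordAlong γ (fun s ↦ V s + W s) t =ᶠ[𝓝 t]
      fun s ↦ coordAlong γ V t s + coordAlong γ W t s := by
  filter_upwards [eventually_mem_baseSet hγ] with s hs
  exact (Trivialization.linear ℝ _ hs).map_add _ _

lemma coordAlong_smul (hγ : MDifferentiableAt 𝓘(ℝ, ℝ) 𝓘(ℝ, F) γ t) :
    coordAlong γ (fun s ↦ f s • V s) t =ᶠ[𝓝 t] fun s ↦ f s • coordAlong γ V t s := by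
  filter_upwards [eventually_mem_baseSet hγ] with s hs
  exact (Trivialization.linear ℝ _ hs).map_smul _ _

lemma DiffAlong.add (hV : DiffAlong γ V t) (hW : DiffAlong γ W t) :
    DiffAlong γ (fun s ↦ V s + W s) t :=
  diffAlong_iff.2 ⟨hV.curve,
    (hV.coord.add hW.coord).congr_of_eventuallyEq (coordAlong_add hV.curve)⟩

lemma DiffAlong.smul (hf : DifferentiableAt ℝ f t) (hV : DiffAlong γ V t) :
    DiffAlong γ (fun s ↦ f s • V s) t :=
  diffAlong_iff.2 ⟨hV.curve,
    (hf.smul hV.coord).congr_of_eventuallyEq (coordAlong_smul hV.curve)⟩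

lemma symm_coordAlong (V : Π t : ℝ, TangentSpace 𝓘(ℝ, F) (γ t)) {s : ℝ}
    (hs : γ s ∈ (trivializationAt F (fun x : M ↦ TangentSpace 𝓘(ℝ, F) x) (γ t)).baseSet) :
    (trivializationAt F (fun x : M ↦ TangentSpace 𝓘(ℝ, F) x) (γ t)).symm (γ s)
      (coordAlong γ V t s) = V s :=
  Trivialization.symm_apply_apply_mk _ hs _

lemma symm_add {e x : M}
    (hx : x ∈ (trivializationAt F (fun x : M ↦ TangentSpace 𝓘(ℝ, F) x) e).baseSet) (a b : F) :
    (trivializationAt F (fun x : M ↦ TangentSpace 𝓘(ℝ, F) x) e).symm x (a + b)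
      = (trivializationAt F (fun x : M ↦ TangentSpace 𝓘(ℝ, F) x) e).symm x a
      + (trivializationAt F (fun x : M ↦ TangentSpace 𝓘(ℝ, F) x) e).symm x b := by
  simp only [← Trivialization.coe_symmₗ (R := ℝ) _ hx, map_add]

lemma symm_smul {e x : M}
    (hx : x ∈ (trivializationAt F (fun x : M ↦ TangentSpace 𝓘(ℝ, F) x) e).baseSet)
    (r : ℝ) (a : F) :
    (trivializationAt F (fun x : M ↦ TangentSpace 𝓘(ℝ, F) x) e).symm x (r • a)
      = r • (trivializationAt F (fun x : M ↦ TangentSpace 𝓘(ℝ, F) x) e).symm x a := by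
  simp only [← Trivialization.coe_symmₗ (R := ℝ) _ hx, map_smul]

lemma apply_congr_of_eventuallyEq {Y Z : Π x : M, TangentSpace 𝓘(ℝ, F) x} {x : M}
    (hY : MDiffAt (T% Y) x) (h : ∀ᶠ y in 𝓝 x, Y y = Z y) : D Y x = D Z x :=
  D.isCovariantDerivativeOn.congr_of_eventuallyEq hY
    (hY.congr_of_eventuallyEq (by filter_upwards [h] with y hy; rw [hy])) Filter.univ_mem h

/-- Extension is additive in the vector near x, on the base set of the trivialization, which
suffices because D is local. -/
lemma apply_extend_add (D : Connection F M) {x : M} (u v : TangentSpace 𝓘(ℝ, F) x) :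
    D (FiberBundle.extend F (u + v)) x
      = D (FiberBundle.extend F u) x + D (FiberBundle.extend F v) x := by
  have hx := FiberBundle.mem_baseSet_trivializationAt F (fun x : M ↦ TangentSpace 𝓘(ℝ, F) x) x
  rw [← D.isCovariantDerivativeOn.add (FiberBundle.mdifferentiableAt_extend ..)
      (FiberBundle.mdifferentiableAt_extend ..)]
  refine apply_congr_of_eventuallyEq (FiberBundle.mdifferentiableAt_extend ..) ?_
  filter_upwards [(Trivialization.open_baseSet _).mem_nhds hx] with y hy
  simp only [FiberBundle.extend, Pi.add_apply, ← symm_add hy]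
  congr 1
  exact (Trivialization.linear ℝ _ hx).map_add _ _

lemma apply_extend_smul (D : Connection F M) {x : M} (a : ℝ) (u : TangentSpace 𝓘(ℝ, F) x) :
    D (FiberBundle.extend F (a • u)) x = a • D (FiberBundle.extend F u) x := by
  have hx := FiberBundle.mem_baseSet_trivializationAt F (fun x : M ↦ TangentSpace 𝓘(ℝ, F) x) x
  rw [← D.isCovariantDerivativeOn.smul_const a (FiberBundle.mdifferentiableAt_extend ..)]
  refine apply_congr_of_eventuallyEq (FiberBundle.mdifferentiableAt_extend ..) ?_
  filter_upwards [(Trivialization.open_baseSet _).mem_nhds hx] with y hy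
  simp only [FiberBundle.extend, Pi.smul_apply, ← symm_smul hy]
  congr 1
  exact (Trivialization.linear ℝ _ hx).map_smul _ _

lemma covDerivAlong_eq (D : Connection F M) (V : Π t : ℝ, TangentSpace 𝓘(ℝ, F) (γ t)) (t : ℝ) :
    covDerivAlong D γ V t =
      (trivializationAt F (fun x : M ↦ TangentSpace 𝓘(ℝ, F) x) (γ t)).symm (γ t)
        (deriv (coordAlong γ V t) t)
      + D (FiberBundle.extend F (V t)) (γ t) (velocity γ t) := rfl

lemma covDerivAlong_add (hV : DiffAlong γ V t) (hW : DiffAlong γ W t) :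
    covDerivAlong D γ (fun s ↦ V s + W s) t
      = covDerivAlong D γ V t + covDerivAlong D γ W t := by
  simp only [covDerivAlong_eq]
  rw [(coordAlong_add hV.curve).deriv_eq, deriv_fun_add hV.coord hW.coord, 
    symm_add (FiberBundle.mem_baseSet_trivializationAt F _ _), apply_extend_add, add_apply]
  abel

lemma covDerivAlong_smul (hf : DifferentiableAt ℝ f t) (hV : DiffAlong γ V t) :
    covDerivAlong D γ (fun s ↦ f s • V s) t
      = f t • covDerivAlong D γ V t + deriv f t • V t := by
  have ht := FiberBundle.mem_baseSet_trivializationAt F (fun x : M ↦ TangentSpace 𝓘(ℝ, F) x) (γ t)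
  simp only [covDerivAlong_eq]
  rw [(coordAlong_smul hV.curve).deriv_eq, deriv_fun_smul hf hV.coord, symm_add ht, symm_smul ht,
    symm_smul ht, apply_extend_smul, symm_coordAlong V ht, smul_apply]
  module

lemma hasDerivAt_comp_curve {G : Type*} [NormedAddCommGroup G] [NormedSpace ℝ G] {u : M → G}
    (hu : MDiffAt u (γ t)) (hγ : MDifferentiableAt 𝓘(ℝ, ℝ) 𝓘(ℝ, F) γ t) :
    HasDerivAt (fun s ↦ u (γ s)) (mvfderiv 𝓘(ℝ, F) u (γ t) (velocity γ t)) t :=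
  HasFDerivAt.hasDerivAt (f' := (mfderiv 𝓘(ℝ, F) 𝓘(ℝ, G) u (γ t) ∘L mfderiv 𝓘(ℝ, ℝ) 𝓘(ℝ, F) γ t :
    ℝ →L[ℝ] G)) (hasMFDerivAt_iff_hasFDerivAt.1 (hu.hasMFDerivAt.comp t hγ.hasMFDerivAt))

/-- The covariant derivative along `γ` of the restriction of a vector field on `M`. -/
lemma covDerivAlong_comp {Y : Π x : M, TangentSpace 𝓘(ℝ, F) x}
    (hγ : MDifferentiableAt 𝓘(ℝ, ℝ) 𝓘(ℝ, F) γ t) (hY : MDiffAt (T% Y) (γ t)) :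
    covDerivAlong D γ (fun s ↦ Y (γ s)) t = D Y (γ t) (velocity γ t) := by
  let e := trivializationAt F (fun x : M ↦ TangentSpace 𝓘(ℝ, F) x) (γ t)
  have he : γ t ∈ e.baseSet := FiberBundle.mem_baseSet_trivializationAt F _ _
  have hcoord : ∀ {Y : Π x : M, TangentSpace 𝓘(ℝ, F) x}, MDiffAt (T% Y) (γ t) →
      MDifferentiableAt 𝓘(ℝ, F) 𝓘(ℝ, F) (fun y ↦ (e ⟨y, Y y⟩).2) (γ t) := fun hY ↦
    (mdifferentiableAt_section _ _).1 hY
  have hcongr : ∀ {u v : M → F}, u =ᶠ[𝓝 (γ t)] v →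
      mvfderiv 𝓘(ℝ, F) u (γ t) (velocity γ t) = mvfderiv 𝓘(ℝ, F) v (γ t) (velocity γ t) :=
    fun {u v} h ↦ by
      have : (mfderiv 𝓘(ℝ, F) 𝓘(ℝ, F) u (γ t) (velocity γ t) : F)
        = mfderiv 𝓘(ℝ, F) 𝓘(ℝ, F) v (γ t) (velocity γ t) := by rw [h.mfderiv_eq]; rfl
      exact this
  -- ∇Y minus the derivative of the chart components is tensorial (the Christoffel term), so it may
  -- be evaluated on the constant-component extension of Y (γ t), whose chart derivative is zero.
  have htens : TensorialAt 𝓘(ℝ, F) F (fun Y : Π x : M, TangentSpace 𝓘(ℝ, F) x ↦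
      D Y (γ t) (velocity γ t) - e.symm (γ t)
        (mvfderiv 𝓘(ℝ, F) (fun y ↦ (e ⟨y, Y y⟩).2) (γ t) (velocity γ t))) (γ t) := by
    refine ⟨fun {f Y} hf hY ↦ ?_, fun {Y Z} hY hZ ↦ ?_⟩
    · have h : (fun y ↦ (e ⟨y, (f • Y) y⟩).2) =ᶠ[𝓝 (γ t)] f • fun y ↦ (e ⟨y, Y y⟩).2 := by
        filter_upwards [e.open_baseSet.mem_nhds he] with y hy
        exact (e.linear ℝ hy).map_smul _ _
      have h3 : e.symm (γ t) (e ⟨γ t, Y (γ t)⟩).2 = Y (γ t) := e.symm_apply_apply_mk he _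
      simp only [hcongr h, mvfderiv_smul hf (hcoord hY), D.isCovariantDerivativeOn.leibniz hY hf]
      simp only [add_apply, smul_apply, ContinuousLinearMap.smulRight_apply, e,
        symm_add he, symm_smul he] at h3 ⊢
      rw [h3]
      module
    · have h : (fun y ↦ (e ⟨y, (Y + Z) y⟩).2) =ᶠ[𝓝 (γ t)]
          (fun y ↦ (e ⟨y, Y y⟩).2) + fun y ↦ (e ⟨y, Z y⟩).2 := by
        filter_upwards [e.open_baseSet.mem_nhds he] with y hy
        exact (e.linear ℝ hy).map_add _ _
      simp only [hcongr h, mvfderiv_add (hcoord hY) (hcoord hZ),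
        D.isCovariantDerivativeOn.add hY hZ, add_apply, e, symm_add he]
      abel
  have h := htens.pointwise hY (FiberBundle.mdifferentiableAt_extend 𝓘(ℝ, F) F (Y (γ t))) (by simp)
  have hconst : (fun y ↦ (e ⟨y, FiberBundle.extend F (Y (γ t)) y⟩).2)
      =ᶠ[𝓝 (γ t)] fun _ ↦ (e ⟨γ t, Y (γ t)⟩).2 := by
    filter_upwards [e.open_baseSet.mem_nhds he] with y hy
    have := congrArg Prod.snd (e.apply_mk_symm hy (e ⟨γ t, Y (γ t)⟩).2)
    exact this
  have h0 : e.symm (γ t) 0 = 0 := by simpa using symm_smul he 0 (0 : F)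
  simp only [hcongr hconst, mvfderiv_const, zero_apply, h0, sub_zero] at h
  rw [covDerivAlong_eq, ← h]
  have h4 : deriv (coordAlong γ (fun s ↦ Y (γ s)) t) t = mvfderiv 𝓘(ℝ, F)
      (fun y ↦ (e ⟨y, Y y⟩).2) (γ t) (velocity γ t) :=
    (hasDerivAt_comp_curve (hcoord hY) hγ).deriv
  rw [h4]
  abel

end Along

/-! ### Metricity and the derivative of φ along a curve, by reduction to ambient fields. -/

section AlongInduction

variable {F : Type*} [NormedAddCommGroup F] [NormedSpace ℝ F] [FiniteDimensional ℝ F]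
  {M : Type*} [TopologicalSpace M] [ChartedSpace F M] [IsManifold 𝓘(ℝ, F) ∞ M] [T2Space M]
  {D : Connection F M} {γ : ℝ → M} {V W : Π t : ℝ, TangentSpace 𝓘(ℝ, F) (γ t)} {f : ℝ → ℝ} {t : ℝ}

lemma SmoothField.diffAlong {Y : Π x : M, TangentSpace 𝓘(ℝ, F) x} (hY : SmoothField Y)
    (hγ : MDifferentiableAt 𝓘(ℝ, ℝ) 𝓘(ℝ, F) γ t) : DiffAlong γ (fun s ↦ Y (γ s)) t :=
  (hY.mdiffAt (γ t)).comp t hγ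

/-- Vector fields along a curve are locally generated over the functions by restrictions of vector
fields on `M`. -/
theorem DiffAlong.induction {P : (Π t : ℝ, TangentSpace 𝓘(ℝ, F) (γ t)) → Prop}
    (hV : DiffAlong γ V t)
    (congr : ∀ V W, P V → (∀ᶠ s in 𝓝 t, V s = W s) → P W)
    (comp : ∀ Y, SmoothField Y → P (fun s ↦ Y (γ s)))
    (smul : ∀ (f : ℝ → ℝ) V, DifferentiableAt ℝ f t → DiffAlong γ V t → P V → P (fun s ↦ f s • V s))
    (add : ∀ V W, DiffAlong γ V t → DiffAlong γ W t → P V → P W → P (fun s ↦ V s + W s)) :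
    P V := by
  let e := trivializationAt F (fun x : M ↦ TangentSpace 𝓘(ℝ, F) x) (γ t)
  have he : γ t ∈ e.baseSet := FiberBundle.mem_baseSet_trivializationAt F _ _
  let b := Module.finBasis ℝ F
  -- Ambient fields that form the chart frame near γ t; the coefficients of V in this frame are its
  -- coordinates.
  choose Y hY _ hYe using fun i ↦ exists_smoothField (e.symm (γ t) (b i))
  let c : Fin (Module.finrank ℝ F) → ℝ → ℝ := fun i s ↦ b.repr (coordAlong γ V t s) i
  have hc : ∀ i, DifferentiableAt ℝ (c i) t := fun i ↦
    (LinearMap.toContinuousLinearMap (b.coord i)).differentiableAt.comp t hV.coord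
  have hsum : ∀ s : Finset (Fin (Module.finrank ℝ F)),
      DiffAlong γ (fun τ ↦ ∑ i ∈ s, c i τ • Y i (γ τ)) t ∧
        P (fun τ ↦ ∑ i ∈ s, c i τ • Y i (γ τ)) := by
    intro s
    induction s using Finset.induction_on with
    | empty =>
      have h0 : SmoothField (0 : Π x : M, TangentSpace 𝓘(ℝ, F) x) := contMDiff_zeroSection _ _
      simp only [Finset.sum_empty]
      exact ⟨h0.diffAlong hV.curve, comp 0 h0⟩
    | insert a s ha h =>
      have h1 := (hY a).diffAlong hV.curve
      simp only [Finset.sum_insert ha]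
      exact ⟨(h1.smul (hc a)).add h.1,
        add _ _ (h1.smul (hc a)) h.1 (smul _ _ (hc a) h1 (comp _ (hY a))) h.2⟩
  refine congr _ _ (hsum Finset.univ).2 ?_
  filter_upwards [hV.curve.continuousAt.eventually (Filter.eventually_all.2 hYe),
    eventually_mem_baseSet hV.curve] with s hs hsb
  have h1 : ∀ i, Y i (γ s) = e.symm (γ s) (b i) := by
    intro i
    rw [hs i]
    have := congrArg Prod.snd (e.apply_mk_symm he (b i))
    exact congrArg (e.symm (γ s)) this
  have h2 : ∀ a : F, e.symmₗ ℝ (γ s) a = e.symm (γ s) a := fun a ↦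
    congrFun (Trivialization.coe_symmₗ e hsb) a
  simp only [h1, ← h2, c, ← map_smul, ← map_sum, b.sum_repr]
  rw [h2]
  exact symm_coordAlong V hsb

section Metric

variable [RiemannianBundle (fun x : M ↦ TangentSpace 𝓘(ℝ, F) x)]
  [IsContMDiffRiemannianBundle 𝓘(ℝ, F) ∞ F (fun x : M ↦ TangentSpace 𝓘(ℝ, F) x)]

/-- The covariant derivative along a curve is metric. -/
theorem IsLeviCivita.hasDerivAt_inner (hD : IsLeviCivita D) (hV : DiffAlong γ V t)
    (hW : DiffAlong γ W t) :
    HasDerivAt (fun s ↦ (inner ℝ (V s) (W s) : ℝ))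
      (inner ℝ (covDerivAlong D γ V t) (W t) + inner ℝ (V t) (covDerivAlong D γ W t)) t := by
  -- Induction on V, and then on W, reduces to restrictions of ambient fields, where the claim is
  -- metricity of D and the chain rule.
  refine hV.induction (P := fun V ↦ HasDerivAt (fun s ↦ (inner ℝ (V s) (W s) : ℝ))
    (inner ℝ (covDerivAlong D γ V t) (W t) + inner ℝ (V t) (covDerivAlong D γ W t)) t)
    (fun V V' h hVV' ↦ ?_) (fun Y hY ↦ ?_) (fun f V hf hV h ↦ ?_) (fun V V' hV hV' h h' ↦ ?_)
  · rw [← covDerivAlong_congr hVV', ← hVV'.self_of_nhds]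
    exact h.congr_of_eventuallyEq (by filter_upwards [hVV'] with s hs; rw [hs])
  · refine hW.induction (P := fun W ↦ HasDerivAt (fun s ↦ (inner ℝ (Y (γ s)) (W s) : ℝ))
      (inner ℝ (covDerivAlong D γ (fun s ↦ Y (γ s)) t) (W t)
        + inner ℝ (Y (γ t)) (covDerivAlong D γ W t)) t)
      (fun V V' h hVV' ↦ ?_) (fun Z hZ ↦ ?_) (fun f V hf hV h ↦ ?_) (fun V V' hV hV' h h' ↦ ?_)
    · rw [← covDerivAlong_congr hVV', ← hVV'.self_of_nhds]
      exact h.congr_of_eventuallyEq (by filter_upwards [hVV'] with s hs; rw [hs])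
    · have h := hasDerivAt_comp_curve ((hY.inner hZ).mdiffAt (γ t)) hV.curve
      rw [hD.mvfderiv_inner hY hZ] at h
      rwa [covDerivAlong_comp hV.curve (hY.mdiffAt _), covDerivAlong_comp hV.curve (hZ.mdiffAt _)]
    · simp only [inner_smul_right, covDerivAlong_smul hf hV, inner_add_right] at h ⊢
      refine (hf.hasDerivAt.mul h).congr_deriv ?_
      ring
    · simp only [inner_add_right, covDerivAlong_add hV hV'] at h h' ⊢
      refine (h.add h').congr_deriv ?_
      ring
  · simp only [real_inner_smul_left, covDerivAlong_smul hf hV, inner_add_left] at h ⊢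
    refine (hf.hasDerivAt.mul h).congr_deriv ?_
    ring
  · simp only [inner_add_left, covDerivAlong_add hV hV'] at h h' ⊢
    refine (h.add h').congr_deriv ?_
    ring

namespace AlmostContactMetric

variable {S : AlmostContactMetric F M}

lemma IsSasakian.covDerivAlong_ξ (hS : S.IsSasakian) (hD : IsLeviCivita D)
    (hγ : MDifferentiableAt 𝓘(ℝ, ℝ) 𝓘(ℝ, F) γ t) :
    covDerivAlong D γ (fun s ↦ S.ξ (γ s)) t = -S.φ (γ t) (velocity γ t) := by
  rw [covDerivAlong_comp hγ ((smoothField_ξ (S := S)).mdiffAt _), (hS.covDeriv hD _).1]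

/-- Differentiability and the formula are proved together because the sum and product rules in the
induction require the former for φV. -/
theorem IsSasakian.covDerivAlong_φ (hS : S.IsSasakian) (hD : IsLeviCivita D)
    (hV : DiffAlong γ V t) :
    DiffAlong γ (fun s ↦ S.φ (γ s) (V s)) t ∧
    covDerivAlong D γ (fun s ↦ S.φ (γ s) (V s)) t = S.φ (γ t) (covDerivAlong D γ V t)
      + (inner ℝ (velocity γ t) (V t) : ℝ) • S.ξ (γ t)
      - (inner ℝ (V t) (S.ξ (γ t)) : ℝ) • velocity γ t := by
  refine hV.induction (P := fun V ↦ DiffAlong γ (fun s ↦ S.φ (γ s) (V s)) t ∧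
    covDerivAlong D γ (fun s ↦ S.φ (γ s) (V s)) t = S.φ (γ t) (covDerivAlong D γ V t)
      + (inner ℝ (velocity γ t) (V t) : ℝ) • S.ξ (γ t)
      - (inner ℝ (V t) (S.ξ (γ t)) : ℝ) • velocity γ t)
    (fun V V' h hVV' ↦ ?_) (fun Y hY ↦ ?_) (fun f V hf hV h ↦ ?_) (fun V V' hV hV' h h' ↦ ?_)
  · have h1 : ∀ᶠ s in 𝓝 t, S.φ (γ s) (V s) = S.φ (γ s) (V' s) := by
      filter_upwards [hVV'] with s hs
      rw [hs]
    rw [← covDerivAlong_congr hVV', ← hVV'.self_of_nhds, ← covDerivAlong_congr h1]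
    exact ⟨h.1.congr h1, h.2⟩
  · have hφ := smoothField_φField (S := S) hY
    refine ⟨hφ.diffAlong hV.curve, ?_⟩
    have h1 := covDerivAlong_comp (D := D) hV.curve (hφ.mdiffAt _)
    rw [(hS.covDeriv hD _).2 _ Y hY] at h1
    rw [covDerivAlong_comp hV.curve (hY.mdiffAt _)]
    exact h1
  · simp only [map_smul, covDerivAlong_smul hf hV, covDerivAlong_smul hf h.1, h.2, map_add,
      inner_smul_right, real_inner_smul_left]
    exact ⟨h.1.smul hf, by module⟩
  · simp only [map_add, covDerivAlong_add hV hV', covDerivAlong_add h.1 h'.1, h.2, h'.2,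
      inner_add_right, inner_add_left]
    exact ⟨h.1.add h'.1, by module⟩

end AlmostContactMetric

end Metric

end AlongInduction

/-! ### Tension and bitension in the Frenet frame. -/

section Frenet

variable {F : Type*} [NormedAddCommGroup F] [NormedSpace ℝ F] [FiniteDimensional ℝ F]
  {M : Type*} [TopologicalSpace M] [ChartedSpace F M] [IsManifold 𝓘(ℝ, F) ∞ M]
  [RiemannianBundle (fun x : M ↦ TangentSpace 𝓘(ℝ, F) x)]
  {D : Connection F M} {J : Set ℝ} {γ : ℝ → M} {r : ℕ}
  {E : ℕ → Π t : ℝ, TangentSpace 𝓘(ℝ, F) (γ t)} {k : ℕ → ℝ → ℝ} {t : ℝ}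

namespace IsFrenetCurve

lemma mdifferentiableAt (h : IsFrenetCurve D J γ r E k) (hJ : IsOpen J) (ht : t ∈ J) :
    MDifferentiableAt 𝓘(ℝ, ℝ) 𝓘(ℝ, F) γ t :=
  ((h.smooth_curve t ht).contMDiffAt (hJ.mem_nhds ht)).mdifferentiableAt (by simp)

lemma diffAlong_of_le (h : IsFrenetCurve D J γ r E k) (hJ : IsOpen J) (ht : t ∈ J) {i : ℕ}
    (hi : 1 ≤ i) (hir : i ≤ r) : DiffAlong γ (E i) t :=
  ((h.smooth_frame i hi hir t ht).contMDiffAt (hJ.mem_nhds ht)).mdifferentiableAt (by simp)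

/-- The zero field is written 0 • E₁ so that its differentiability and derivative follow from the
product rule. -/
lemma eventually_eq_zero (h : IsFrenetCurve D J γ r E k) (hJ : IsOpen J) (ht : t ∈ J) {i : ℕ}
    (hir : r < i) : ∀ᶠ s in 𝓝 t, (0 : ℝ) • E 1 s = E i s := by
  filter_upwards [hJ.mem_nhds ht] with s hs
  rw [h.frame_eq_zero i hir s hs, zero_smul]

lemma diffAlong (h : IsFrenetCurve D J γ r E k) (hJ : IsOpen J) (ht : t ∈ J) {i : ℕ}
    (hi : 1 ≤ i) : DiffAlong γ (E i) t := by
  rcases le_or_gt i r with hir | hir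
  · exact h.diffAlong_of_le hJ ht hi hir
  · exact ((h.diffAlong_of_le hJ ht le_rfl h.one_le).smul
      (f := fun _ ↦ 0) (differentiableAt_const _)).congr (h.eventually_eq_zero hJ ht hir)

lemma contDiffOn (h : IsFrenetCurve D J γ r E k) {i : ℕ} (hi : 1 ≤ i) :
    ContDiffOn ℝ ∞ (k i) J := by
  rcases lt_or_ge i r with hir | hir
  · exact h.smooth_curvature i hi hir
  · exact (contDiffOn_const (c := (0 : ℝ))).congr fun s hs ↦ h.curvature_eq_zero i hir s hs

lemma differentiableAt (h : IsFrenetCurve D J γ r E k) (hJ : IsOpen J) (ht : t ∈ J) {i : ℕ}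
    (hi : 1 ≤ i) : DifferentiableAt ℝ (k i) t :=
  ((h.contDiffOn hi t ht).contDiffAt (hJ.mem_nhds ht)).differentiableAt (by simp)

lemma differentiableAt_deriv (h : IsFrenetCurve D J γ r E k) (hJ : IsOpen J) (ht : t ∈ J) {i : ℕ}
    (hi : 1 ≤ i) : DifferentiableAt ℝ (deriv (k i)) t :=
  ((((h.contDiffOn hi).deriv_of_isOpen (m := 1) hJ
    (WithTop.coe_le_coe.2 le_top : ((2 : ℕ∞) : ℕ∞ω) ≤ ∞)) t ht).contDiffAt
      (hJ.mem_nhds ht)).differentiableAt (by simp)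

/-- The Frenet equations hold for all indices, with the convention on vanishing symbols. -/
lemma covDerivAlong_eq (h : IsFrenetCurve D J γ r E k) (hJ : IsOpen J) (ht : t ∈ J) {i : ℕ}
    (hi : 1 ≤ i) :
    covDerivAlong D γ (E i) t = -(k (i - 1) t) • E (i - 1) t + k i t • E (i + 1) t := by
  rcases le_or_gt i r with hir | hir
  · exact h.frenet i hi hir t ht
  · rw [← covDerivAlong_congr (h.eventually_eq_zero hJ ht hir),
      covDerivAlong_smul (f := fun _ ↦ 0) (differentiableAt_const _)
        (h.diffAlong_of_le hJ ht le_rfl h.one_le),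
      h.curvature_eq_zero (i - 1) (by omega) t ht, h.curvature_eq_zero i hir.le t ht]
    simp

/-- The unspecified field `E 0` drops out because its coefficient is k₀ = 0. -/
lemma covDerivAlong_one (h : IsFrenetCurve D J γ r E k) (hJ : IsOpen J) (ht : t ∈ J) :
    covDerivAlong D γ (E 1) t = k 1 t • E 2 t := by
  simp [h.covDerivAlong_eq hJ ht le_rfl, h.curvature_zero t ht]

lemma inner_eq (h : IsFrenetCurve D J γ r E k) (ht : t ∈ J) {i j : ℕ} (hi : 1 ≤ i) (hj : 1 ≤ j)
    (hij : i ≠ j) : (inner ℝ (E i t) (E j t) : ℝ) = 0 := by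
  rcases le_or_gt i r with hir | hir
  · rcases le_or_gt j r with hjr | hjr
    · rw [h.orthonormal t ht i j hi hir hj hjr, if_neg hij]
    · rw [h.frame_eq_zero j hjr t ht, inner_zero_right]
  · rw [h.frame_eq_zero i hir t ht, inner_zero_left]

lemma inner_self (h : IsFrenetCurve D J γ r E k) (ht : t ∈ J) {i : ℕ} (hi : 1 ≤ i) (hir : i ≤ r) :
    (inner ℝ (E i t) (E i t) : ℝ) = 1 := by
  rw [h.orthonormal t ht i i hi hir hi hir, if_pos rfl]

lemma tension_eq (h : IsFrenetCurve D J γ r E k) (hJ : IsOpen J) (ht : t ∈ J) :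
    tension D γ t = k 1 t • E 2 t := by
  rw [tension, ← h.covDerivAlong_one hJ ht]
  refine covDerivAlong_congr ?_
  filter_upwards [hJ.mem_nhds ht] with s hs using (h.frame_one s hs).symm

lemma covDerivAlong_tension (h : IsFrenetCurve D J γ r E k) (hJ : IsOpen J) (ht : t ∈ J) :
    covDerivAlong D γ (tension D γ) t
      = (-(k 1 t * k 1 t)) • E 1 t + deriv (k 1) t • E 2 t + (k 1 t * k 2 t) • E 3 t := by
  have h1 : ∀ᶠ s in 𝓝 t, tension D γ s = k 1 s • E 2 s := by
    filter_upwards [hJ.mem_nhds ht] with s hs using h.tension_eq hJ hs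
  rw [covDerivAlong_congr h1, covDerivAlong_smul (h.differentiableAt hJ ht le_rfl)
    (h.diffAlong hJ ht one_le_two), h.covDerivAlong_eq hJ ht one_le_two]
  module

lemma covDerivAlong_covDerivAlong_tension (h : IsFrenetCurve D J γ r E k) (hJ : IsOpen J)
    (ht : t ∈ J) :
    covDerivAlong D γ (covDerivAlong D γ (tension D γ)) t
      = (-3 * k 1 t * deriv (k 1) t) • E 1 t
      + (deriv (deriv (k 1)) t - k 1 t ^ 3 - k 1 t * k 2 t ^ 2) • E 2 t
      + (2 * deriv (k 1) t * k 2 t + k 1 t * deriv (k 2) t) • E 3 t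
      + (k 1 t * k 2 t * k 3 t) • E 4 t := by
  have h1 : ∀ᶠ s in 𝓝 t, covDerivAlong D γ (tension D γ) s
      = (-(k 1 s * k 1 s)) • E 1 s + deriv (k 1) s • E 2 s + (k 1 s * k 2 s) • E 3 s := by
    filter_upwards [hJ.mem_nhds ht] with s hs using h.covDerivAlong_tension hJ hs
  have d1 := h.differentiableAt hJ ht (i := 1) le_rfl
  have d2 := h.differentiableAt hJ ht (i := 2) one_le_two
  have d3 := h.differentiableAt_deriv hJ ht (i := 1) le_rfl
  have e1 := h.diffAlong hJ ht (i := 1) le_rfl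
  have e2 := h.diffAlong hJ ht (i := 2) one_le_two
  have e3 := h.diffAlong hJ ht (i := 3) (by norm_num)
  have d11 : DifferentiableAt ℝ (fun s ↦ -(k 1 s * k 1 s)) t := (d1.mul d1).neg
  have d12 : DifferentiableAt ℝ (fun s ↦ k 1 s * k 2 s) t := d1.mul d2
  have v11 : deriv (fun s ↦ -(k 1 s * k 1 s)) t
      = -(deriv (k 1) t * k 1 t + k 1 t * deriv (k 1) t) :=
    (d1.hasDerivAt.mul d1.hasDerivAt).neg.deriv
  have v12 : deriv (fun s ↦ k 1 s * k 2 s) t = deriv (k 1) t * k 2 t + k 1 t * deriv (k 2) t :=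
    (d1.hasDerivAt.mul d2.hasDerivAt).deriv
  rw [covDerivAlong_congr h1, covDerivAlong_add ((e1.smul d11).add (e2.smul d3)) (e3.smul d12),
    covDerivAlong_add (e1.smul d11) (e2.smul d3), covDerivAlong_smul d11 e1,
    covDerivAlong_smul d3 e2, covDerivAlong_smul d12 e3, h.covDerivAlong_one hJ ht,
    h.covDerivAlong_eq hJ ht one_le_two, h.covDerivAlong_eq hJ ht (i := 3) (by norm_num), v11, v12]
  module

end IsFrenetCurve

variable [T2Space M]
  [IsContMDiffRiemannianBundle 𝓘(ℝ, F) ∞ F (fun x : M ↦ TangentSpace 𝓘(ℝ, F) x)]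
  {S : AlmostContactMetric F M} {c : ℝ}

namespace AlmostContactMetric

lemma inner_φ_self (S : AlmostContactMetric F M) {x : M} (u : TangentSpace 𝓘(ℝ, F) x) :
    (inner ℝ (S.φ x u) u : ℝ) = 0 := by
  have h := S.inner_φ_left u u
  rw [real_inner_comm (S.φ x u)] at h
  rw [real_inner_comm] at *
  linarith

lemma inner_velocity_ξ (hL : ∀ t ∈ J, S.η (γ t) (velocity γ t) = 0) (ht : t ∈ J) :
    (inner ℝ (velocity γ t) (S.ξ (γ t)) : ℝ) = 0 := by
  rw [← S.η_eq_inner, hL t ht]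

/-- The first normal of a Legendre Frenet curve in a Sasakian manifold is orthogonal to `ξ`. -/
lemma IsSasakian.inner_normal_ξ (hS : S.IsSasakian) (hD : IsLeviCivita D) (hJ : IsOpen J)
    (h : IsFrenetCurve D J γ r E k) (hL : ∀ t ∈ J, S.η (γ t) (velocity γ t) = 0) (ht : t ∈ J) :
    (inner ℝ (E 2 t) (S.ξ (γ t)) : ℝ) = 0 := by
  rcases le_or_gt 2 r with hr | hr
  · have hγ := h.mdifferentiableAt hJ ht
    have h1 := hD.hasDerivAt_inner (h.diffAlong hJ ht le_rfl)
      ((smoothField_ξ (S := S)).diffAlong hγ)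
    have h2 : (fun s ↦ (inner ℝ (E 1 s) (S.ξ (γ s)) : ℝ)) =ᶠ[𝓝 t] fun _ ↦ 0 := by
      filter_upwards [hJ.mem_nhds ht] with s hs
      rw [h.frame_one s hs, inner_velocity_ξ hL hs]
    -- The derivative of g(T, ξ) = 0 is k₁ g(E₂, ξ) - g(T, φT), and the last term vanishes.
    have h3 := h1.unique ((hasDerivAt_const t (0 : ℝ)).congr_of_eventuallyEq h2)
    rw [h.covDerivAlong_one hJ ht, hS.covDerivAlong_ξ hD hγ, h.frame_one t ht, inner_neg_right,
      real_inner_comm (S.φ (γ t) _), S.inner_φ_self, real_inner_smul_left, neg_zero, add_zero] at h3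
    exact (mul_eq_zero.1 h3).resolve_left (h.curvature_pos 1 le_rfl hr t ht).ne'
  · rw [h.frame_eq_zero 2 hr t ht, inner_zero_left]

/-- Here (∇_Tφ)T = ξ is orthogonal to E₂, φ(∇_T T) = k₁ φE₂ is orthogonal to E₂, and φT is
orthogonal to T; only the k₂E₃ part of ∇_T E₂ survives. -/
lemma IsSasakian.hasDerivAt_inner_φ (hS : S.IsSasakian) (hD : IsLeviCivita D) (hJ : IsOpen J)
    (h : IsFrenetCurve D J γ r E k) (hL : ∀ t ∈ J, S.η (γ t) (velocity γ t) = 0) (ht : t ∈ J) :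
    HasDerivAt (fun s ↦ (inner ℝ (S.φ (γ s) (velocity γ s)) (E 2 s) : ℝ))
      (k 2 t * inner ℝ (S.φ (γ t) (velocity γ t)) (E 3 t)) t := by
  obtain ⟨h1, h2⟩ := hS.covDerivAlong_φ hD (h.diffAlong hJ ht (i := 1) le_rfl)
  have h3 := hD.hasDerivAt_inner h1 (h.diffAlong hJ ht one_le_two)
  have h4 : (fun s ↦ (inner ℝ (S.φ (γ s) (velocity γ s)) (E 2 s) : ℝ)) =ᶠ[𝓝 t]
      fun s ↦ inner ℝ (S.φ (γ s) (E 1 s)) (E 2 s) := by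
    filter_upwards [hJ.mem_nhds ht] with s hs
    rw [h.frame_one s hs]
  refine (h3.congr_of_eventuallyEq h4).congr_deriv ?_
  rw [h2, h.covDerivAlong_one hJ ht, h.covDerivAlong_eq hJ ht one_le_two, h.frame_one t ht,
    inner_velocity_ξ hL ht]
  simp only [map_smul, inner_add_left, inner_sub_left, real_inner_smul_left, S.inner_φ_self,
    inner_add_right, real_inner_smul_right, real_inner_comm (E 2 t) (S.ξ (γ t)),
    hS.inner_normal_ξ hD hJ h hL ht]
  simp [h.frame_one t ht, S.inner_φ_self]

/-- The curvature term is -R(T, τ)T = k₁ R(E₂, T)T, to which `curvature_eq` applies because T and E₂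
are orthogonal to ξ. For small r the absent symbols are zero and the formula persists. -/
theorem IsSasakianSpaceForm.bitension_eq (hS : S.IsSasakianSpaceForm D c) (hD : IsLeviCivita D)
    (hJ : IsOpen J) (h : IsFrenetCurve D J γ r E k)
    (hL : ∀ t ∈ J, S.η (γ t) (velocity γ t) = 0) (ht : t ∈ J) :
    bitension D γ t = (-3 * k 1 t * deriv (k 1) t) • E 1 t
      + (deriv (deriv (k 1)) t - k 1 t ^ 3 - k 1 t * k 2 t ^ 2 + (c + 3) / 4 * k 1 t) • E 2 t
      + (2 * deriv (k 1) t * k 2 t + k 1 t * deriv (k 2) t) • E 3 t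
      + (k 1 t * k 2 t * k 3 t) • E 4 t
      + (3 * ((c - 1) / 4) * k 1 t * inner ℝ (S.φ (γ t) (velocity γ t)) (E 2 t)) •
        S.φ (γ t) (velocity γ t) := by
  have h1 : (inner ℝ (velocity (F := F) γ t) (velocity γ t) : ℝ) = 1 := by
    rw [← h.frame_one t ht, h.inner_self ht le_rfl h.one_le]
  have h2 : (inner ℝ (velocity (F := F) γ t) (E 2 t) : ℝ) = 0 := by
    rw [← h.frame_one t ht, h.inner_eq ht le_rfl one_le_two (by norm_num)]
  rw [bitension, h.covDerivAlong_covDerivAlong_tension hJ ht, curvature_swap, h.tension_eq hJ ht,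
    curvature_smul_left hD, hS.curvature_eq hD (inner_velocity_ξ hL ht)
      (hS.sasakian.inner_normal_ξ hD hJ h hL ht), h1, h2,
    real_inner_comm (S.φ (γ t) (velocity γ t)) (E 2 t)]
  module

end AlmostContactMetric

end Frenet

/-! ### Componentwise form of the equation and the global alternative. -/

section Classification

variable {F : Type*} [NormedAddCommGroup F] [NormedSpace ℝ F] [FiniteDimensional ℝ F]
  {M : Type*} [TopologicalSpace M] [ChartedSpace F M] [IsManifold 𝓘(ℝ, F) ∞ M]
  [RiemannianBundle (fun x : M ↦ TangentSpace 𝓘(ℝ, F) x)]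
  {D : Connection F M} {J : Set ℝ} {γ : ℝ → M} {r : ℕ}
  {E : ℕ → Π t : ℝ, TangentSpace 𝓘(ℝ, F) (γ t)} {k : ℕ → ℝ → ℝ} {t : ℝ}

/-- The component of `v` orthogonal to `E₂, E₃, E₄`. -/
def normalPart (E : ℕ → Π t : ℝ, TangentSpace 𝓘(ℝ, F) (γ t)) (t : ℝ)
    (v : TangentSpace 𝓘(ℝ, F) (γ t)) : TangentSpace 𝓘(ℝ, F) (γ t) :=
  v - ((inner ℝ v (E 2 t) : ℝ) • E 2 t + (inner ℝ v (E 3 t) : ℝ) • E 3 t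
    + (inner ℝ v (E 4 t) : ℝ) • E 4 t)

namespace IsFrenetCurve

lemma inner_normalPart (h : IsFrenetCurve D J γ r E k) (ht : t ∈ J)
    {v : TangentSpace 𝓘(ℝ, F) (γ t)} (hv : (inner ℝ v (E 1 t) : ℝ) = 0) {i : ℕ} (hi : 1 ≤ i)
    (hi4 : i ≤ 4) : (inner ℝ (normalPart E t v) (E i t) : ℝ) = 0 := by
  rcases le_or_gt i r with hir | hir
  · have hs := h.inner_self ht hi hir
    have ho : ∀ j, 1 ≤ j → j ≠ i → (inner ℝ (E j t) (E i t) : ℝ) = 0 := fun j hj hij ↦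
      h.inner_eq ht hj hi hij
    simp only [normalPart, inner_sub_left, inner_add_left, real_inner_smul_left]
    interval_cases i
    · simp [hv, ho]
    · simp [hs, ho, -inner_self_eq_norm_sq_to_K]
    · simp [hs, ho, -inner_self_eq_norm_sq_to_K]
    · simp [hs, ho, -inner_self_eq_norm_sq_to_K]
  · rw [h.frame_eq_zero i hir t ht, inner_zero_right]

/-- Connects the remainder with the span in condition 1. Frame vectors beyond r are zero, so
subtracting all three projections is harmless; for r = 1 both sides say v = 0. -/
lemma normalPart_eq_zero_iff (h : IsFrenetCurve D J γ r E k) (ht : t ∈ J)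
    {v : TangentSpace 𝓘(ℝ, F) (γ t)} :
    normalPart E t v = 0 ↔ v ∈ Submodule.span ℝ ((fun i ↦ E i t) '' Set.Icc 2 (min r 4)) := by
  constructor
  · intro hv
    have hmem : ∀ i, 2 ≤ i → i ≤ 4 →
        E i t ∈ Submodule.span ℝ ((fun i ↦ E i t) '' Set.Icc 2 (min r 4)) := by
      intro i hi hi4
      rcases le_or_gt i r with hir | hir
      · exact Submodule.subset_span ⟨i, ⟨hi, le_min hir hi4⟩, rfl⟩
      · rw [h.frame_eq_zero i hir t ht]
        exact Submodule.zero_mem _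
    rw [sub_eq_zero.1 hv]
    exact Submodule.add_mem _ (Submodule.add_mem _
      (Submodule.smul_mem _ _ (hmem 2 (by norm_num) (by norm_num)))
      (Submodule.smul_mem _ _ (hmem 3 (by norm_num) (by norm_num))))
      (Submodule.smul_mem _ _ (hmem 4 (by norm_num) (by norm_num)))
  · intro hv
    induction hv using Submodule.span_induction with
    | mem w hw =>
      obtain ⟨i, ⟨hi2, him⟩, rfl⟩ := hw
      have hs := h.inner_self ht (i := i) (by omega) (by omega)
      have ho : ∀ j, 1 ≤ j → i ≠ j → (inner ℝ (E i t) (E j t) : ℝ) = 0 := fun j hj hij ↦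
        h.inner_eq ht (by omega) hj hij
      have hi4 : i ≤ 4 := by omega
      simp only [normalPart]
      interval_cases i
      · simp [hs, ho, -inner_self_eq_norm_sq_to_K]
      · simp [hs, ho, -inner_self_eq_norm_sq_to_K]
      · simp [hs, ho, -inner_self_eq_norm_sq_to_K]
    | zero => simp [normalPart]
    | add u w _ _ hu hw =>
      have : normalPart E t (u + w) = normalPart E t u + normalPart E t w := by
        simp only [normalPart, inner_add_left]
        module
      rw [this, hu, hw, add_zero]
    | smul a u _ hu =>
      have : normalPart E t (a • u) = a • normalPart E t u := by
        simp only [normalPart, real_inner_smul_left]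
        module
      rw [this, hu, smul_zero]

/-- Components with respect to the first Frenet vectors. -/
lemma combination_eq_zero_iff (h : IsFrenetCurve D J γ r E k) (ht : t ∈ J)
    {v : TangentSpace 𝓘(ℝ, F) (γ t)} (hv : (inner ℝ v (E 1 t) : ℝ) = 0) {a₁ a₂ a₃ a₄ b : ℝ} :
    a₁ • E 1 t + a₂ • E 2 t + a₃ • E 3 t + a₄ • E 4 t + b • normalPart E t v = 0 ↔
      (a₁ = 0 ∧ (2 ≤ r → a₂ = 0) ∧ (3 ≤ r → a₃ = 0) ∧ (4 ≤ r → a₄ = 0)) ∧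
        b • normalPart E t v = 0 := by
  constructor
  · intro h0
    have hcomp : ∀ i, 1 ≤ i → i ≤ 4 → i ≤ r →
        (inner ℝ (a₁ • E 1 t + a₂ • E 2 t + a₃ • E 3 t + a₄ • E 4 t) (E i t) : ℝ) = 0 := by
      intro i hi hi4 hir
      rw [eq_neg_of_add_eq_zero_left h0, inner_neg_left, real_inner_smul_left,
        h.inner_normalPart ht hv hi hi4, mul_zero, neg_zero]
    have ho : ∀ i j, 1 ≤ i → 1 ≤ j → i ≠ j → (inner ℝ (E i t) (E j t) : ℝ) = 0 :=
      fun i j hi hj hij ↦ h.inner_eq ht hi hj hij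
    simp only [inner_add_left, real_inner_smul_left] at hcomp
    have h1 : a₁ = 0 := by
      simpa [ho, -inner_self_eq_norm_sq_to_K, h.inner_self ht le_rfl h.one_le] using hcomp 1 le_rfl (by norm_num) h.one_le
    have h2 : 2 ≤ r → a₂ = 0 := fun hr ↦ by
      simpa [ho, -inner_self_eq_norm_sq_to_K, h.inner_self ht one_le_two hr] using hcomp 2 (by norm_num) (by norm_num) hr
    have h3 : 3 ≤ r → a₃ = 0 := fun hr ↦ by
      simpa [ho, -inner_self_eq_norm_sq_to_K, h.inner_self ht (i := 3) (by norm_num) hr]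
        using hcomp 3 (by norm_num) (by norm_num) hr
    have h4 : 4 ≤ r → a₄ = 0 := fun hr ↦ by
      simpa [ho, -inner_self_eq_norm_sq_to_K, h.inner_self ht (i := 4) (by norm_num) hr]
        using hcomp 4 (by norm_num) (by norm_num) hr
    refine ⟨⟨h1, h2, h3, h4⟩, ?_⟩
    have hz : ∀ i (a : ℝ), (i ≤ r → a = 0) → a • E i t = 0 := fun i a ha ↦ by
      rcases le_or_gt i r with hir | hir
      · rw [ha hir, zero_smul]
      · rw [h.frame_eq_zero i hir t ht, smul_zero]
    rwa [hz 1 a₁ fun _ ↦ h1, hz 2 a₂ h2, hz 3 a₃ h3, hz 4 a₄ h4, add_zero, add_zero, add_zero,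
      zero_add] at h0
  · rintro ⟨⟨h1, h2, h3, h4⟩, h5⟩
    have hz : ∀ i (a : ℝ), (i ≤ r → a = 0) → a • E i t = 0 := fun i a ha ↦ by
      rcases le_or_gt i r with hir | hir
      · rw [ha hir, zero_smul]
      · rw [h.frame_eq_zero i hir t ht, smul_zero]
    rw [hz 1 a₁ fun _ ↦ h1, hz 2 a₂ h2, hz 3 a₃ h3, hz 4 a₄ h4, h5]
    simp

end IsFrenetCurve

variable [T2Space M]
  [IsContMDiffRiemannianBundle 𝓘(ℝ, F) ∞ F (fun x : M ↦ TangentSpace 𝓘(ℝ, F) x)]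
  {S : AlmostContactMetric F M} {c δ₁ δ₂ : ℝ}

namespace AlmostContactMetric

/-- The sesqui-harmonic equation of a Legendre Frenet curve at a given time, in components. -/
theorem IsSasakianSpaceForm.sesquiHarmonic_iff (hS : S.IsSasakianSpaceForm D c)
    (hD : IsLeviCivita D) (hJ : IsOpen J) (h : IsFrenetCurve D J γ r E k)
    (hL : ∀ t ∈ J, S.η (γ t) (velocity γ t) = 0) (ht : t ∈ J) :
    δ₂ • bitension D γ t - δ₁ • tension D γ t = 0 ↔
      (-3 * δ₂ * k 1 t * deriv (k 1) t = 0 ∧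
        (2 ≤ r → δ₂ * (deriv (deriv (k 1)) t - k 1 t ^ 3 - k 1 t * k 2 t ^ 2
            + (c + 3) / 4 * k 1 t + 3 * ((c - 1) / 4) * k 1 t *
              (inner ℝ (S.φ (γ t) (velocity γ t)) (E 2 t) : ℝ) ^ 2) - δ₁ * k 1 t = 0) ∧
        (3 ≤ r → δ₂ * (2 * deriv (k 1) t * k 2 t + k 1 t * deriv (k 2) t
            + 3 * ((c - 1) / 4) * k 1 t * (inner ℝ (S.φ (γ t) (velocity γ t)) (E 2 t) : ℝ) *
              (inner ℝ (S.φ (γ t) (velocity γ t)) (E 3 t) : ℝ)) = 0) ∧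
        (4 ≤ r → δ₂ * (k 1 t * k 2 t * k 3 t
            + 3 * ((c - 1) / 4) * k 1 t * (inner ℝ (S.φ (γ t) (velocity γ t)) (E 2 t) : ℝ) *
              (inner ℝ (S.φ (γ t) (velocity γ t)) (E 4 t) : ℝ)) = 0)) ∧
      (δ₂ * (3 * ((c - 1) / 4)) * k 1 t * (inner ℝ (S.φ (γ t) (velocity γ t)) (E 2 t) : ℝ)) •
        normalPart E t (S.φ (γ t) (velocity γ t)) = 0 := by
  have hv : (inner ℝ (S.φ (γ t) (velocity γ t)) (E 1 t) : ℝ) = 0 := by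
    rw [h.frame_one t ht, S.inner_φ_self]
  -- φT is its components along E₂, E₃, E₄ plus `normalPart`; the components join the Frenet
  -- coefficients.
  rw [← h.combination_eq_zero_iff ht hv, hS.bitension_eq hD hJ h hL ht, h.tension_eq hJ ht,
    normalPart]
  refine Eq.congr_left ?_
  module

/-- Along a sesqui-harmonic Legendre curve that is not a geodesic, `g(φT, E₂)²` is constant. -/
theorem IsSasakianSpaceForm.inner_φ_sq_eq (hS : S.IsSasakianSpaceForm D c) (hD : IsLeviCivita D)
    (hJ : IsOpen J) (hJ' : J.OrdConnected) (h : IsFrenetCurve D J γ r E k)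
    (hL : ∀ t ∈ J, S.η (γ t) (velocity γ t) = 0) (hr : 2 ≤ r) (hc : c ≠ 1) (hδ : δ₂ ≠ 0)
    (hZ : ∀ t ∈ J, δ₂ • bitension D γ t - δ₁ • tension D γ t = 0) {t s : ℝ} (ht : t ∈ J)
    (hs : s ∈ J) :
    (inner ℝ (S.φ (γ t) (velocity γ t)) (E 2 t) : ℝ) ^ 2
      = inner ℝ (S.φ (γ s) (velocity γ s)) (E 2 s) ^ 2 := by
  set f : ℝ → ℝ := fun t ↦ inner ℝ (S.φ (γ t) (velocity γ t)) (E 2 t) with hf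
  have hf' : ∀ t ∈ J, HasDerivAt f (k 2 t * inner ℝ (S.φ (γ t) (velocity γ t)) (E 3 t)) t :=
    fun t ht ↦ hS.sasakian.hasDerivAt_inner_φ hD hJ h hL ht
  have hpos : ∀ t ∈ J, k 1 t ≠ 0 := fun t ht ↦ (h.curvature_pos 1 le_rfl hr t ht).ne'
  have hk1 : ∀ t ∈ J, deriv (k 1) t = 0 := fun t ht ↦ by
    have := ((hS.sesquiHarmonic_iff hD hJ h hL ht).1 (hZ t ht)).1.1
    simpa [hδ, hpos t ht] using this
  have hk2 : ∀ t ∈ J, deriv (deriv (k 1)) t = 0 := fun t ht ↦ by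
    have : deriv (k 1) =ᶠ[𝓝 t] fun _ ↦ 0 := by
      filter_upwards [hJ.mem_nhds ht] with s hs using hk1 s hs
    rw [this.deriv_eq, deriv_const]
  have hzero : ∀ t ∈ J, f t * (k 2 t * inner ℝ (S.φ (γ t) (velocity γ t)) (E 3 t)) = 0 := by
    intro t ht
    -- The second equation divided by δ₂k₁, with k₁'' = 0.
    have hg : (fun t ↦ 3 * ((c - 1) / 4) * f t ^ 2 - k 1 t ^ 2 - k 2 t ^ 2) =ᶠ[𝓝 t]
        fun _ ↦ δ₁ / δ₂ - (c + 3) / 4 := by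
      filter_upwards [hJ.mem_nhds ht] with s hs
      have h2 := ((hS.sesquiHarmonic_iff hD hJ h hL hs).1 (hZ s hs)).1.2.1 hr
      rw [hk2 s hs] at h2
      have h3 : k 1 s * (δ₂ * (3 * ((c - 1) / 4) * f s ^ 2 - k 1 s ^ 2 - k 2 s ^ 2
          + (c + 3) / 4) - δ₁) = 0 := by linear_combination h2
      have h4 := (mul_eq_zero.1 h3).resolve_left (hpos s hs)
      field_simp
      linear_combination 4 * h4
    have d1 := (h.differentiableAt hJ ht (i := 1) le_rfl).hasDerivAt
    have d2 := (h.differentiableAt hJ ht (i := 2) one_le_two).hasDerivAt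
    have h5 := (((((hf' t ht).pow 2).const_mul (3 * ((c - 1) / 4))).sub (d1.pow 2)).sub
      (d2.pow 2)).unique ((hasDerivAt_const t (δ₁ / δ₂ - (c + 3) / 4)).congr_of_eventuallyEq hg)
    rw [hk1 t ht] at h5
    norm_num at h5
    rcases le_or_gt 3 r with hr3 | hr3
    · have h3 := ((hS.sesquiHarmonic_iff hD hJ h hL ht).1 (hZ t ht)).1.2.2.1 hr3
      rw [hk1 t ht] at h3
      have h6 : δ₂ * k 1 t * (deriv (k 2) t + 3 * ((c - 1) / 4) * f t *
          inner ℝ (S.φ (γ t) (velocity γ t)) (E 3 t)) = 0 := by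
        linear_combination h3
      have h7 := (mul_eq_zero.1 h6).resolve_left (mul_ne_zero hδ (hpos t ht))
      -- The k₂k₂' terms of the differentiated second equation and of k₂ times the third cancel; the
      -- f f' terms add up.
      have h8 : (c - 1) * (f t * (k 2 t * inner ℝ (S.φ (γ t) (velocity γ t)) (E 3 t))) = 0 := by
        linear_combination (1 / 3) * h5 + (2 / 3) * k 2 t * h7
      exact (mul_eq_zero.1 h8).resolve_left (sub_ne_zero.2 hc)
    · rw [h.frame_eq_zero 3 hr3 t ht, inner_zero_right, mul_zero, mul_zero]
  refine hJ.is_const_of_deriv_eq_zero hJ'.isPreconnected (f := fun t ↦ f t ^ 2)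
    (fun t ht ↦ ((hf' t ht).pow 2).differentiableAt.differentiableWithinAt) (fun t ht ↦ ?_) ht hs
  rw [show deriv (fun t ↦ f t ^ 2) t = _ from ((hf' t ht).pow 2).deriv]
  have := hzero t ht
  simp only [Pi.zero_apply]
  push_cast
  linear_combination 2 * this

end AlmostContactMetric

end Classification

end

end SesquiHarmonic

/-! ### The characterization of interpolating sesqui-harmonic Legendre curves. -/

theorem theorem3p1 (n : ℕ) {F : Type*} [NormedAddCommGroup F] [NormedSpace ℝ F]
    [FiniteDimensional ℝ F] (hF : Module.finrank ℝ F = 2 * n + 1)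
    -- the Riemannian manifold `M` of dimension `2 * n + 1`
    {M : Type*} [TopologicalSpace M] [T2Space M] [ChartedSpace F M] [IsManifold 𝓘(ℝ, F) ∞ M]
    [RiemannianBundle (fun x : M ↦ TangentSpace 𝓘(ℝ, F) x)]
    [IsContMDiffRiemannianBundle 𝓘(ℝ, F) ∞ F (fun x : M ↦ TangentSpace 𝓘(ℝ, F) x)]
    -- the Levi-Civita connection of `M`
    (D : Connection F M) (hD : IsLeviCivita D)
    -- the Sasakian space form `M(c)`
    (S : AlmostContactMetric F M) (c : ℝ) (hS : S.IsSasakianSpaceForm D c)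
    -- the Legendre curve `γ : J → M(c)` of osculating order `r`
    (J : Set ℝ) (hJ : IsOpen J) (hJ' : J.OrdConnected) (γ : ℝ → M) (r : ℕ)
    (E : ℕ → Π t : ℝ, TangentSpace 𝓘(ℝ, F) (γ t)) (k : ℕ → ℝ → ℝ)
    (hγ : IsFrenetCurve D J γ r E k)
    (hL : ∀ t ∈ J, S.η (γ t) (velocity γ t) = 0)
    (m : ℕ) (hm : m = min r 4)
    (δ₁ δ₂ : ℝ) (hδ : (δ₁, δ₂) ≠ (0, 0)) :
    IsInterpolatingSesquiHarmonic D δ₁ δ₂ J γ ↔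
      (c = 1 ∨
        (∀ t ∈ J, inner ℝ (S.φ (γ t) (velocity γ t)) (E 2 t) = (0 : ℝ)) ∨
        (∀ t ∈ J, S.φ (γ t) (velocity γ t) ∈
          Submodule.span ℝ ((fun i ↦ E i t) '' Set.Icc 2 m))) ∧
      ((1 ≤ m → ∀ t ∈ J, -3 * δ₂ * k 1 t * deriv (k 1) t = 0) ∧
        (2 ≤ m → ∀ t ∈ J,
          δ₂ * (deriv (deriv (k 1)) t - k 1 t ^ 3 - k 1 t * k 2 t ^ 2 + (c + 3) / 4 * k 1 t
            + 3 * ((c - 1) / 4) * k 1 t *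
              (inner ℝ (S.φ (γ t) (velocity γ t)) (E 2 t) : ℝ) ^ 2
            - (c - 1) / 4 * k 1 t * S.η (γ t) (E 2 t) ^ 2) - δ₁ * k 1 t = 0) ∧
        (3 ≤ m → ∀ t ∈ J,
          δ₂ * (2 * deriv (k 1) t * k 2 t + k 1 t * deriv (k 2) t
            + 3 * ((c - 1) / 4) * k 1 t *
              (inner ℝ (S.φ (γ t) (velocity γ t)) (E 2 t) : ℝ) *
              (inner ℝ (S.φ (γ t) (velocity γ t)) (E 3 t) : ℝ)
            - (c - 1) / 4 * k 1 t * S.η (γ t) (E 2 t) * S.η (γ t) (E 3 t)) = 0) ∧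
        (4 ≤ m → ∀ t ∈ J,
          δ₂ * (k 1 t * k 2 t * k 3 t
            + 3 * ((c - 1) / 4) * k 1 t *
              (inner ℝ (S.φ (γ t) (velocity γ t)) (E 2 t) : ℝ) *
              (inner ℝ (S.φ (γ t) (velocity γ t)) (E 4 t) : ℝ)
            - (c - 1) / 4 * k 1 t * S.η (γ t) (E 2 t) * S.η (γ t) (E 4 t)) = 0)) := by
  have hη : ∀ t ∈ J, S.η (γ t) (E 2 t) = 0 := fun t ht ↦ by
    rw [S.η_eq_inner, hS.sasakian.inner_normal_ξ hD hJ hγ hL ht]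
  have hspan : ∀ t ∈ J, normalPart E t (S.φ (γ t) (velocity γ t)) = 0 ↔
      S.φ (γ t) (velocity γ t) ∈ Submodule.span ℝ ((fun i ↦ E i t) '' Set.Icc 2 m) :=
    fun t ht ↦ by rw [hγ.normalPart_eq_zero_iff ht, hm]
  have hr := hγ.one_le
  constructor
  · intro hZ
    have hcomp := fun t ht ↦ (hS.sesquiHarmonic_iff hD hJ hγ hL (t := t) ht).1 (hZ t ht)
    refine ⟨?_, fun _ t ht ↦ (hcomp t ht).1.1, fun h t ht ↦ ?_, fun h t ht ↦ ?_, fun h t ht ↦ ?_⟩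
    · refine or_iff_not_imp_left.2 fun hc ↦ ?_
      by_cases hf : ∀ t ∈ J, inner ℝ (S.φ (γ t) (velocity γ t)) (E 2 t) = (0 : ℝ)
      · exact Or.inl hf
      refine Or.inr fun t ht ↦ (hspan t ht).1 ?_
      push Not at hf
      obtain ⟨s, hs, hfs⟩ := hf
      have hr2 : 2 ≤ r := by
        by_contra hr2
        exact hfs (by rw [hγ.frame_eq_zero 2 (by omega) s hs, inner_zero_right])
      have hpos : ∀ t ∈ J, k 1 t ≠ 0 := fun t ht ↦ (hγ.curvature_pos 1 le_rfl hr2 t ht).ne'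
      -- If δ₂ = 0, the second equation reads δ₁k₁ = 0 with k₁ > 0, so both parameters would vanish.
      have hδ₂ : δ₂ ≠ 0 := by
        rintro rfl
        have h2 := (hcomp s hs).1.2.1 hr2
        rw [zero_mul, zero_sub, neg_eq_zero] at h2
        exact hδ (by rw [(mul_eq_zero.1 h2).resolve_right (hpos s hs)])
      -- Constancy of g(φT, E₂)² spreads its nonvanishing from s to every t, which makes the
      -- pointwise alternative global.
      have hft : (inner ℝ (S.φ (γ t) (velocity γ t)) (E 2 t) : ℝ) ≠ 0 := fun h0 ↦ by
        have h := hS.inner_φ_sq_eq hD hJ hJ' hγ hL hr2 hc hδ₂ hZ ht hs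
        rw [h0, zero_pow two_ne_zero] at h
        exact hfs (pow_eq_zero_iff two_ne_zero |>.1 h.symm)
      have hc' : (3 * ((c - 1) / 4) : ℝ) ≠ 0 := by
        have := sub_ne_zero.2 hc
        positivity
      exact (smul_eq_zero.1 (hcomp t ht).2).resolve_left
        (mul_ne_zero (mul_ne_zero (mul_ne_zero hδ₂ hc') (hpos t ht)) hft)
    · rw [hη t ht]
      linear_combination (hcomp t ht).1.2.1 (by omega)
    · rw [hη t ht]
      linear_combination (hcomp t ht).1.2.2.1 (by omega)
    · rw [hη t ht]
      linear_combination (hcomp t ht).1.2.2.2 (by omega)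
  · rintro ⟨hcond, h1, h2, h3, h4⟩ t ht
    refine (hS.sesquiHarmonic_iff hD hJ hγ hL ht).2
      ⟨⟨h1 (by omega) t ht, fun h ↦ ?_, fun h ↦ ?_, fun h ↦ ?_⟩, ?_⟩
    · have := h2 (by omega) t ht
      rw [hη t ht] at this
      linear_combination this
    · have := h3 (by omega) t ht
      rw [hη t ht] at this
      linear_combination this
    · have := h4 (by omega) t ht
      rw [hη t ht] at this
      linear_combination this
    -- Each of the three alternatives annihilates one factor of the `normalPart` term.
    · rcases hcond with rfl | hf | hf
      · simp
      · rw [hf t ht, mul_zero, zero_smul]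
      · rw [(hspan t ht).2 (hf t ht), smul_zero]
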